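/- Let $\mathcal M=(S,\mathbf P,\mu)$ be a finite Markov chain, let $p_{\min}$ be its smallest positive transition probability, and let $r:S\to[0,1]$ be a reward function. Let $\mathbb P$ be the probability measure on state sequences $s_0s_1\cdots$ with $\mathbb P[s_0\cdots s_k\text{ is a prefix}]=\mu(s_0)\prod_{i=1}^k\mathbf P(s_{i-1},s_i)$. Graphs and candidates. In a directed graph, a non-empty vertex set is strongly connected if any two of its vertices (also a vertex and itself) are joined by a path with at least one edge; a BSCC is a maximal strongly connected set which no edge leaves. The BSCCs of $\mathcal M$ are those of the graph $\{(s,s'):\mathbf P(s,s')>0\}$. The graph of a finite path $\pi=s_0\cdots s_n$ has as edges the pairs $(s_i,s_{i+1})$. The candidate $K(\pi)$ is the (unique, if it exists) BSCC of the graph of $\pi$ that is the set of states of some suffix $\kappa$ of $\pi$; otherwise $K(\pi)=\bot$. For real $k$, it is a $k$-candidate of $\pi$ if $\kappa$ can be chosen such that each of its states occurs at least $k$ times in $\kappa$ and the last state of $\kappa$ occurs at least $k+1$ times. $C$ is a strong $k$-candidate of $\pi$ if $\pi=\alpha\beta b\gamma$ with $b$ a state such that no state of $C$ occurs in $\alpha$,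 the set of states of $\beta b\gamma$ is $C$, $K(\alpha\beta)\ne C$, $K(\alpha\beta b)=C$, and $C$ is a $k$-candidate of $b\gamma$. The algorithm. For $0<\delta'$, $\mathrm{ReachedBSCC}(\pi,p_{\min},\delta')$ answers yes iff $i\ge1$ and $K(\pi)\neq\bot$ is a strong $k_i$-candidate of $\pi$, where $i$ is the number of elements of the sequence of candidates of the prefixes of $\pi$, with undefined elements deleted and consecutive repetitions removed, and $k_i=\frac{i-\log_2\delta'}{-\log_2(1-p_{\min})}$ ($k_i=0$ if $p_{\min}=1$). $\mathrm{SinglePathMP}(r,p_{\min},\varepsilon,\delta)$ extends a path $\pi$ of $\mathcal M$, sampled from $\mu$ and $\mathbf P$, state by state, until for the first time $K(\pi)\ne\bot$, $\mathrm{ReachedBSCC}(\pi,p_{\min},\delta/2)$ answers yes, and $K(\pi)$ is a strong $k$-candidate of $\pi$ for $$k=\frac{\ln(2|K(\pi)|^2)-\ln(\delta/2)}{2\xi^2},\qquad \xi=p_{\min}\bigl((1+\varepsilon)^{1/(2|K(\pi)|)}-1\bigr).$$ It then returns $\widehat{\mathsf{MP}}_{C}$, where $C=K(\pi)$. Here $\mathsf{MP}_C$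 (for $C$ a BSCC of $\mathcal M$) is the mean payoff of the chain inside $C$, that is, the common limit $\lim_n\frac1n\sum_{i=0}^{n-1}(\mathbf P^i r)(s)$ for all $s\in C$, and $\widehat{\mathsf{MP}}_C$ is the same limit for the matrix $\hat{\mathbf P}$, where $\hat{\mathbf P}(s,s')$ is the number of occurrences of $s$ immediately followed by $s'$ in $\pi$ divided by the number of occurrences of $s$ in $\pi$ that are followed by some state. Theorem. For all $\varepsilon>0$ and $\delta>0$, with probability at least $1-\delta$ the algorithm $\mathrm{SinglePathMP}(r,p_{\min},\varepsilon,\delta)$ terminates correctly: it stops after finitely many steps with a path $\pi$ whose candidate $C=K(\pi)$ is a BSCC of $\mathcal M$, the mean payoffs $\widehat{\mathsf{MP}}_{C}$ and $\mathsf{MP}_C$ exist, and $|\widehat{\mathsf{MP}}_{C}-\mathsf{MP}_C|<\varepsilon$. -/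

import Mathlib

open MeasureTheory ProbabilityTheory Filter Topology

/-! ### Strongly connected sets of a directed graph -/

/-- `C` is strongly connected for the edge relation `E`: it is non-empty and there is a path (with
at least one edge) between any two of its elements. In particular a single vertex is strongly
connected only if it lies on a cycle. -/
def IsSC {S : Type*} (E : S → S → Prop) (C : Finset S) : Prop :=
  C.Nonempty ∧ ∀ s ∈ C, ∀ t ∈ C, Relation.TransGen E s t

/-- `C` is a bottom strongly connected component: a maximal strongly connected set that no edge
leaves. -/
def IsBSCC {S : Type*} (E : S → S → Prop) (C : Finset S) : Prop :=
  Maximal (IsSC E) C ∧ ∀ s ∈ C, ∀ t, t ∉ C → ¬ E s t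

/-! ### Finite Markov chains -/

/-- A Markov chain `(S, P, μ)` on the finite set `S`. -/
structure MarkovChain (S : Type*) [Fintype S] where
  /-- the transition probability matrix -/
  P : Matrix S S ℝ
  P_nonneg : ∀ s t, 0 ≤ P s t
  P_sum : ∀ s, ∑ t, P s t = 1
  /-- the initial distribution -/
  μ : S → ℝ
  μ_nonneg : ∀ s, 0 ≤ μ s
  μ_sum : ∑ s, μ s = 1

/-- The measure on the finite set `S` whose point masses are given by `w`. -/
noncomputable def weightMeasure {S : Type*} [Fintype S] [MeasurableSpace S] (w : S → ℝ) :
    Measure S :=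
  ∑ t, ENNReal.ofReal (w t) • Measure.dirac t

lemma weightMeasure_singleton {S : Type*} [Fintype S] [MeasurableSpace S]
    [DiscreteMeasurableSpace S] (w : S → ℝ) (t : S) :
    weightMeasure w {t} = ENNReal.ofReal (w t) := by
  classical
  simp [weightMeasure, Measure.finsetSum_apply, Set.indicator_apply]

lemma isProbabilityMeasure_weightMeasure {S : Type*} [Fintype S] [MeasurableSpace S]
    {w : S → ℝ} (h0 : ∀ s, 0 ≤ w s) (h1 : ∑ s, w s = 1) :
    IsProbabilityMeasure (weightMeasure w) := by
  constructor
  simp only [weightMeasure, Measure.finsetSum_apply, Measure.smul_apply, measure_univ, smul_eq_mul,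
    mul_one]
  rw [← ENNReal.ofReal_sum_of_nonneg (fun i _ => h0 i), h1, ENNReal.ofReal_one]

namespace MarkovChain

/-- The smallest positive transition probability. -/
noncomputable def pmin {S : Type*} [Fintype S] (M : MarkovChain S) : ℝ :=
  sInf {x | 0 < x ∧ ∃ s t, x = M.P s t}

/-- The bottom strongly connected components of the chain. -/
def IsBSCC {S : Type*} [Fintype S] (M : MarkovChain S) (C : Finset S) : Prop :=
  _root_.IsBSCC (fun s t => 0 < M.P s t) C

/-- The transition kernel: given the first `n + 1` states, the next state is distributed
according to the row of `P` of the last one. -/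
noncomputable def stepKernel {S : Type*} [Fintype S] [MeasurableSpace S]
    [DiscreteMeasurableSpace S] (M : MarkovChain S) (n : ℕ) :
    Kernel (Π _ : Finset.Iic n, S) S where
  toFun a := weightMeasure (M.P (a ⟨n, by simp⟩))
  measurable' :=
    (measurable_of_finite (fun s : S => weightMeasure (M.P s))).comp
      (measurable_pi_apply (⟨n, by simp⟩ : Finset.Iic n))

instance {S : Type*} [Fintype S] [MeasurableSpace S] [DiscreteMeasurableSpace S]
    (M : MarkovChain S) (n : ℕ) : IsMarkovKernel (M.stepKernel n) :=
  ⟨fun _ => isProbabilityMeasure_weightMeasure (M.P_nonneg _) (M.P_sum _)⟩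

/-- The probability measure on infinite state sequences `s₀ s₁ s₂ ⋯` induced by the chain
(see `runMeasure_cone`). -/
noncomputable def runMeasure {S : Type*} [Fintype S] [MeasurableSpace S]
    [DiscreteMeasurableSpace S] (M : MarkovChain S) : Measure (ℕ → S) :=
  Kernel.trajMeasure (X := fun _ => S) (weightMeasure M.μ) M.stepKernel

instance {S : Type*} [Fintype S] [MeasurableSpace S] [DiscreteMeasurableSpace S]
    (M : MarkovChain S) : IsProbabilityMeasure M.runMeasure := by
  have := isProbabilityMeasure_weightMeasure M.μ_nonneg M.μ_sum
  unfold runMeasure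
  infer_instance

/-- The Markov property of `runMeasure`. -/
lemma runMeasure_step {S : Type*} [Fintype S] [MeasurableSpace S] [DiscreteMeasurableSpace S]
    (M : MarkovChain S) (n : ℕ) (s t : S) (A : Set (Π _ : Finset.Iic n, S))
    (hA : ∀ y ∈ A, y ⟨n, by simp⟩ = s) :
    M.runMeasure {ρ | Preorder.frestrictLe (π := fun _ => S) n ρ ∈ A ∧ ρ (n + 1) = t} =
      M.runMeasure {ρ | Preorder.frestrictLe (π := fun _ => S) n ρ ∈ A} *
        ENNReal.ofReal (M.P s t) := by
  have hAm : MeasurableSet A := A.toFinite.measurableSet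
  have := isProbabilityMeasure_weightMeasure M.μ_nonneg M.μ_sum
  have h := Kernel.map_frestrictLe_trajMeasure_compProd_eq_map_trajMeasure (X := fun _ => S)
    (μ₀ := weightMeasure M.μ) (κ := M.stepKernel) (a := n)
  have h2 := DFunLike.congr_fun h (A ×ˢ {t})
  rw [Measure.compProd_apply_prod hAm (measurableSet_singleton t),
    Measure.map_apply (by fun_prop) (hAm.prod (measurableSet_singleton t))] at h2
  have h3 : M.runMeasure {ρ | Preorder.frestrictLe (π := fun _ => S) n ρ ∈ A ∧ ρ (n + 1) = t} =
      ∫⁻ y in A, M.stepKernel n y {t} ∂(M.runMeasure.map (Preorder.frestrictLe n)) := h2.symm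
  rw [h3, setLIntegral_congr_fun (g := fun _ => ENNReal.ofReal (M.P s t)) hAm, setLIntegral_const,
    Measure.map_apply (by fun_prop) hAm, mul_comm]
  · rfl
  · intro y hy
    change weightMeasure (M.P (y ⟨n, by simp⟩)) {t} = _
    rw [weightMeasure_singleton, hA y hy]

lemma runMeasure_zero {S : Type*} [Fintype S] [MeasurableSpace S] [DiscreteMeasurableSpace S]
    (M : MarkovChain S) (s : S) : M.runMeasure {ρ | ρ 0 = s} = ENNReal.ofReal (M.μ s) := by
  have := isProbabilityMeasure_weightMeasure M.μ_nonneg M.μ_sum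
  have hm : Measurable (fun ρ : ℕ → S => ρ 0) := measurable_pi_apply 0
  have e : M.runMeasure.map (fun ρ : ℕ → S => ρ 0) = weightMeasure M.μ := by
    have e1 : (fun ρ : ℕ → S => ρ 0) = (fun y : Π _ : Finset.Iic 0, S => y ⟨0, by simp⟩) ∘
        (Preorder.frestrictLe (π := fun _ => S) 0) := rfl
    unfold runMeasure Kernel.trajMeasure
    rw [e1, ← Measure.map_map (by fun_prop) (by fun_prop), Measure.map_comp _ _ (by fun_prop),
      Kernel.traj_map_frestrictLe, Kernel.partialTraj_self, Measure.id_comp,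
      Measure.map_map (by fun_prop) (by fun_prop)]
    exact Measure.map_id
  rw [← weightMeasure_singleton, ← e, Measure.map_apply hm (measurableSet_singleton s)]
  rfl

/-- The probability of the cone of the path `a₀ ⋯ aₖ`. -/
theorem runMeasure_cone {S : Type*} [Fintype S] [MeasurableSpace S] [DiscreteMeasurableSpace S]
    (M : MarkovChain S) (a : ℕ → S) (k : ℕ) :
    M.runMeasure {ρ | ∀ i ≤ k, ρ i = a i} =
      ENNReal.ofReal (M.μ (a 0) * ∏ i ∈ Finset.range k, M.P (a i) (a (i + 1))) := by
  induction k with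
  | zero => simpa using M.runMeasure_zero (a 0)
  | succ k ih =>
    have h := M.runMeasure_step k (a k) (a (k + 1))
      {y | ∀ i : Finset.Iic k, y i = a i} (fun y hy => hy ⟨k, by simp⟩)
    have e1 : {ρ : ℕ → S | ∀ i ≤ k, ρ i = a i} =
        {ρ | Preorder.frestrictLe (π := fun _ => S) k ρ ∈
          {y : Π _ : Finset.Iic k, S | ∀ i : Finset.Iic k, y i = a i}} := by
      ext ρ; simp [Preorder.frestrictLe]
    have e2 : {ρ : ℕ → S | ∀ i ≤ k + 1, ρ i = a i} =
        {ρ | Preorder.frestrictLe (π := fun _ => S) k ρ ∈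
          {y : Π _ : Finset.Iic k, S | ∀ i : Finset.Iic k, y i = a i} ∧
            ρ (k + 1) = a (k + 1)} := by
      ext ρ
      simp only [Preorder.frestrictLe, Set.mem_ofPred_eq, Subtype.forall, Finset.mem_Iic]
      constructor
      · exact fun h => ⟨fun i hi => h i (by omega), h _ le_rfl⟩
      · rintro ⟨h1, h2⟩ i hi
        rcases Nat.lt_or_ge k i with h | h
        · obtain rfl : i = k + 1 := by omega
          exact h2
        · exact h1 i h
    rw [e2, h, ← e1, ih, ← ENNReal.ofReal_mul
      (mul_nonneg (M.μ_nonneg _) (Finset.prod_nonneg fun i _ => M.P_nonneg _ _)),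
      Finset.prod_range_succ, mul_assoc]

lemma pow_nonneg {S : Type*} [Fintype S] [DecidableEq S] (M : MarkovChain S) (i : ℕ) (s t : S) :
    0 ≤ (M.P ^ i) s t := by
  induction i generalizing s t with
  | zero => rw [pow_zero, Matrix.one_apply]; split_ifs <;> norm_num
  | succ i ih =>
    rw [pow_succ, Matrix.mul_apply]
    exact Finset.sum_nonneg fun u _ => mul_nonneg (ih _ _) (M.P_nonneg _ _)

/-- The distribution of the `i`-th state. -/
lemma runMeasure_state {S : Type*} [Fintype S] [DecidableEq S] [MeasurableSpace S]
    [DiscreteMeasurableSpace S] (M : MarkovChain S) (i : ℕ) (t : S) :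
    M.runMeasure.real {ρ | ρ i = t} = ∑ s, M.μ s * (M.P ^ i) s t := by
  induction i generalizing t with
  | zero => simp [Measure.real, M.runMeasure_zero, M.μ_nonneg, Matrix.one_apply]
  | succ i ih =>
    have h1 : {ρ : ℕ → S | ρ (i + 1) = t} =
        ⋃ u ∈ (Finset.univ : Finset S), {ρ | ρ i = u ∧ ρ (i + 1) = t} := by
      ext ρ; simp
    have hm : ∀ u : S, MeasurableSet {ρ : ℕ → S | ρ i = u ∧ ρ (i + 1) = t} := fun u =>
      (measurableSet_eq_fun (measurable_pi_apply i) measurable_const).inter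
        (measurableSet_eq_fun (measurable_pi_apply (i + 1)) measurable_const)
    rw [h1, measureReal_biUnion_finset _ (fun u _ => hm u)]
    · have h2 : ∀ u : S, M.runMeasure.real {ρ | ρ i = u ∧ ρ (i + 1) = t} =
          (∑ s, M.μ s * (M.P ^ i) s u) * M.P u t := by
        intro u
        rw [← ih u]
        have := M.runMeasure_step i u t {y | y ⟨i, by simp⟩ = u} (fun y hy => hy)
        have h3 := congrArg ENNReal.toReal this
        rw [ENNReal.toReal_mul, ENNReal.toReal_ofReal (M.P_nonneg _ _)] at h3
        exact h3
      simp_rw [h2, pow_succ, Matrix.mul_apply, Finset.sum_mul, Finset.mul_sum]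
      rw [Finset.sum_comm]
      simp_rw [mul_assoc]
    · intro u _ v _ huv
      refine Set.disjoint_left.2 fun ρ h1 h2 => huv (h1.1.symm.trans h2.1)

/-- The expected reward of the `i`-th state; when `μ` is concentrated in `s`, this is
`(P ^ i *ᵥ r) s`. -/
theorem integral_reward {S : Type*} [Fintype S] [DecidableEq S] [MeasurableSpace S]
    [DiscreteMeasurableSpace S] (M : MarkovChain S) (r : S → ℝ) (i : ℕ) :
    ∫ ρ, r (ρ i) ∂M.runMeasure = ∑ s, M.μ s * (M.P ^ i).mulVec r s := by
  have hm : Measurable (fun ρ : ℕ → S => ρ i) := measurable_pi_apply i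
  have := Measure.isProbabilityMeasure_map (μ := M.runMeasure) hm.aemeasurable
  have h1 : ∫ ρ, r (ρ i) ∂M.runMeasure = ∫ t, r t ∂(M.runMeasure.map (fun ρ : ℕ → S => ρ i)) :=
    (integral_map hm.aemeasurable (measurable_of_finite r).aestronglyMeasurable).symm
  rw [h1, integral_fintype Integrable.of_finite]
  have h2 : ∀ t : S, (M.runMeasure.map (fun ρ : ℕ → S => ρ i)).real {t} =
      ∑ s, M.μ s * (M.P ^ i) s t := by
    intro t
    rw [← M.runMeasure_state, map_measureReal_apply hm (measurableSet_singleton t)]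
    rfl
  simp_rw [h2, Matrix.mulVec, dotProduct, smul_eq_mul, Finset.sum_mul, Finset.mul_sum]
  rw [Finset.sum_comm]
  simp_rw [mul_assoc]

end MarkovChain

/-! ### Paths, their graphs and candidates

A path `s₀ ⋯ sₙ` is the list `[s₀, …, sₙ]`. -/

/-- The path `s₀ ⋯ sₙ` that is the prefix of the run `ρ`. -/
def runPrefix {S : Type*} (ρ : ℕ → S) (n : ℕ) : List S := (List.range (n + 1)).map ρ

/-- The number `#_{ss'}(π)` of positions at which `s` is immediately followed by `s'`. -/
def transCount {S : Type*} [DecidableEq S] (π : List S) (s s' : S) : ℕ :=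
  (π.zip π.tail).count (s, s')

/-- The number of positions of `π` at which `s` is followed by some state, i.e. the number of
times that a successor of `s` was sampled along `π`. -/
def stateCount {S : Type*} [DecidableEq S] (π : List S) (s : S) : ℕ := π.dropLast.count s

/-- The edges of the graph of a path: pairs of consecutive states. -/
def pathEdge {S : Type*} (π : List S) (s t : S) : Prop := (s, t) ∈ π.zip π.tail

/-- `C` is the candidate of `π`: the support of a suffix of `π` and a BSCC of the graph of `π`. -/
def IsCandidate {S : Type*} [DecidableEq S] (π : List S) (C : Finset S) : Prop :=
  ∃ κ : List S, κ <:+ π ∧ κ.toFinset = C ∧ IsBSCC (pathEdge π) C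

/-- `C` is a `k`-candidate of `π`: moreover each state of `C` has at least `k` occurrences in the
suffix, and the last state of the suffix has at least `k + 1` occurrences. -/
def IsKCandidate {S : Type*} [DecidableEq S] (k : ℝ) (π : List S) (C : Finset S) : Prop :=
  ∃ κ : List S, κ <:+ π ∧ κ.toFinset = C ∧ IsBSCC (pathEdge π) C ∧
    (∀ s ∈ C, k ≤ (κ.count s : ℝ)) ∧ ∃ h : κ ≠ [], k + 1 ≤ (κ.count (κ.getLast h) : ℝ)

/-- A path has at most one candidate. -/
lemma IsCandidate.unique {S : Type*} [DecidableEq S] {π : List S} {C D : Finset S}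
    (hC : IsCandidate π C) (hD : IsCandidate π D) : C = D := by
  obtain ⟨κ, ⟨η, hκ⟩, hκC, hCB⟩ := hC
  obtain ⟨κ', ⟨η', hκ'⟩, hκD, hDB⟩ := hD
  have n1 : κ ≠ [] := by
    rintro rfl
    obtain ⟨x, hx⟩ := hCB.1.prop.1
    simp [← hκC] at hx
  have n2 : κ' ≠ [] := by
    rintro rfl
    obtain ⟨x, hx⟩ := hDB.1.prop.1
    simp [← hκD] at hx
  have e : κ.getLast n1 = κ'.getLast n2 := by
    have h1 : (η ++ κ).getLast (by simp [n1]) = κ.getLast n1 := List.getLast_append_of_ne_nil _ n1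
    have h2 : (η' ++ κ').getLast (by simp [n2]) = κ'.getLast n2 :=
      List.getLast_append_of_ne_nil _ n2
    rw [← h1, ← h2]
    congr 1
    rw [hκ, hκ']
  have m1 : κ.getLast n1 ∈ C := by
    rw [← hκC, List.mem_toFinset]; exact List.getLast_mem n1
  have m2 : κ.getLast n1 ∈ D := by
    rw [← hκD, e, List.mem_toFinset]; exact List.getLast_mem n2
  have hU : IsSC (pathEdge π) (C ∪ D) := by
    refine ⟨⟨_, Finset.mem_union_left _ m1⟩, fun s hs t ht => ?_⟩
    have h1 : Relation.TransGen (pathEdge π) s (κ.getLast n1) := by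
      rcases Finset.mem_union.1 hs with h | h
      · exact hCB.1.prop.2 s h _ m1
      · exact hDB.1.prop.2 s h _ m2
    have h2 : Relation.TransGen (pathEdge π) (κ.getLast n1) t := by
      rcases Finset.mem_union.1 ht with h | h
      · exact hCB.1.prop.2 _ m1 t h
      · exact hDB.1.prop.2 _ m2 t h
    exact h1.trans h2
  rw [hCB.1.eq_of_le hU Finset.subset_union_left]
  exact (hDB.1.eq_of_le hU Finset.subset_union_right).symm

open Classical in
/-- The candidate `K(π)`, with `none` for `⊥`. -/
noncomputable def candidate {S : Type*} [DecidableEq S] (π : List S) : Option (Finset S) :=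
  if h : ∃ C, IsCandidate π C then some h.choose else none

lemma candidate_eq_some_iff {S : Type*} [DecidableEq S] {π : List S} {C : Finset S} :
    candidate π = some C ↔ IsCandidate π C := by
  unfold candidate
  split_ifs with h
  · rw [Option.some_inj]
    exact ⟨fun e => e ▸ h.choose_spec, fun hC => h.choose_spec.unique hC⟩
  · simpa using fun hC => h ⟨C, hC⟩

/-- `C` is a strong `k`-candidate of `π = α β b γ`: the states of `C` are first seen in `β`, `b` is
the moment at which `C` becomes the candidate, and `C` is a `k`-candidate already of `b γ`. -/
def IsStrongKCandidate {S : Type*} [DecidableEq S] (k : ℝ) (C : Finset S) (π : List S) : Prop :=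
  ∃ (α β : List S) (b : S) (γ : List S), π = α ++ β ++ b :: γ ∧
    (∀ s ∈ α, s ∉ C) ∧ (β ++ b :: γ).toFinset = C ∧
    candidate (α ++ β) ≠ some C ∧ candidate (α ++ β ++ [b]) = some C ∧
    IsKCandidate k (b :: γ) C

/-! ### The procedure `ReachedBSCC` -/

open Classical in
/-- One iteration of the loop of `ReachedBSCC` on the registers `(C, i)`, for the prefix `η`. -/
noncomputable def candidateStep {S : Type*} [DecidableEq S] (c : Option (Finset S) × ℕ)
    (η : List S) : Option (Finset S) × ℕ :=
  if candidate η ≠ none ∧ candidate η ≠ c.1 then (candidate η, c.2 + 1) else c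

/-- The value of the counter `i` after the loop: the number of candidates met along `π`. -/
noncomputable def candidateIndex {S : Type*} [DecidableEq S] (π : List S) : ℕ :=
  (π.inits.foldl candidateStep (none, 0)).2

/-- The required strength `kᵢ = (i - log₂ δ) / (- log₂ (1 - p))`. For `p = 1` the conventions
`logb 2 0 = 0` and `x / 0 = 0` give `kᵢ = 0`, the limit of the formula as `p → 1`. -/
noncomputable def bsccStrength (p δ : ℝ) (i : ℕ) : ℝ :=
  (i - Real.logb 2 δ) / (-Real.logb 2 (1 - p))

/-- `ReachedBSCC(π, p, δ)` answers yes. -/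
def ReachedBSCC {S : Type*} [DecidableEq S] (p δ : ℝ) (π : List S) : Prop :=
  1 ≤ candidateIndex π ∧
    ∃ C, candidate π = some C ∧ IsStrongKCandidate (bsccStrength p δ (candidateIndex π)) C π

/-! ### Mean payoff -/

/-- `x` is the mean payoff of the closed set of states `C` under the transition matrix `Q`:
`(Q ^ i *ᵥ r) s` is the expected reward of the `i`-th state of the chain with transition matrix `Q`
started in `s` (see `MarkovChain.integral_reward`), and for every `s ∈ C` the expected averages of
the first `n` rewards converge to `x`. -/
def HasMeanPayoff {S : Type*} [Fintype S] [DecidableEq S] (Q : Matrix S S ℝ) (r : S → ℝ)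
    (C : Finset S) (x : ℝ) : Prop :=
  ∀ s ∈ C, Tendsto (fun n : ℕ => (1 / (n : ℝ)) * ∑ i ∈ Finset.range n, (Q ^ i).mulVec r s)
    atTop (𝓝 x)

/-- The estimated transition matrix of the path `π`. -/
noncomputable def estMatrix {S : Type*} [DecidableEq S] (π : List S) : Matrix S S ℝ :=
  fun s s' => (transCount π s s' : ℝ) / (stateCount π s : ℝ)

/-! ### The procedure `SinglePathMP` -/

/-- The precision `ξ = p ((1 + ε) ^ (1 / (2 m)) - 1)` of the transition probabilities needed for a
candidate with `m` states. -/
noncomputable def transErr (p ε : ℝ) (m : ℕ) : ℝ := p * ((1 + ε) ^ (1 / (2 * (m : ℝ))) - 1)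

/-- The strength `(ln (2 m²) - ln (δ / 2)) / (2 ξ²)` required of a candidate with `m` states. -/
noncomputable def mpStrength (p ε δ : ℝ) (m : ℕ) : ℝ :=
  (Real.log (2 * (m : ℝ) ^ 2) - Real.log (δ / 2)) / (2 * transErr p ε m ^ 2)

/-- The exit condition of the loop of `SinglePathMP`. -/
def SinglePathMPUntil {S : Type*} [DecidableEq S] (p ε δ : ℝ) (π : List S) : Prop :=
  ReachedBSCC p (δ / 2) π ∧
    ∃ C, candidate π = some C ∧ IsStrongKCandidate (mpStrength p ε δ C.card) C π

/-- On the generated state sequence `ρ`, `SinglePathMP` terminates with the path `s₀ ⋯ sₙ`, whose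
candidate is `C`, and returns `x`, the mean payoff of `C` under the estimated matrix. -/
def SinglePathMPReturns {S : Type*} [Fintype S] [DecidableEq S] (r : S → ℝ) (p ε δ : ℝ)
    (ρ : ℕ → S) (C : Finset S) (x : ℝ) : Prop :=
  ∃ n, SinglePathMPUntil p ε δ (runPrefix ρ n) ∧
    (∀ m < n, ¬ SinglePathMPUntil p ε δ (runPrefix ρ m)) ∧
    candidate (runPrefix ρ n) = some C ∧ HasMeanPayoff (estMatrix (runPrefix ρ n)) r C x

/-!
The run of a finite chain almost surely uses positive transitions only and ends up in a BSCC `D` of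
the chain, visiting all its states infinitely often (`MarkovChain.exists_limit_isBSCC`). From some
time on the candidate is `D`, so the counter of candidates is constant, the required strengths are
constant too, and the procedure stops (`exists_singlePathMPUntil`). It remains to bound the
probabilities of two errors by `δ / 2` each. Both bounds follow the same pattern: a stopping time
fixes the set of states in question (`MarkovChain.runMeasure_le_of_first_time`), and Ville's
inequality for a multiplicative supermartingale bounds the error afterwards
(`MarkovChain.maximal_inequality`).

* *The candidate is not a BSCC of the chain.* The `i`-th candidate, at its birth, then has an exit
  of probability at least `pmin`. To be accepted it has to survive `kᵢ` visits of the source of the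
  exit, which has probability at most `(1 - pmin) ^ kᵢ = 2⁻ⁱ δ / 2`
  (`MarkovChain.wrong_candidate_le`), and these bounds are summed over `i`. That the strong
  candidate counts visits from its birth on is what makes the bound applicable
  (`IsStrongKCandidate.birth`).
* *The transition probabilities in the BSCC are estimated badly.* The number of samples of a state
  at the end is random, so a bound for all numbers of samples above the required strength at once is
  needed. The supermartingale behind Hoeffding's inequality gives it without loss
  (`MarkovChain.deviation_le`), and there are `m ^ 2` pairs of states in a BSCC with `m` states
  (`MarkovChain.wrong_estimate_le`).

If neither error occurs, the estimates have relative error at most `η = (1 + ε) ^ (1 / (2 m)) - 1`.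
Replacing one row of an irreducible stochastic matrix after the other multiplies the entries of the
invariant measure, suitably scaled, by factors between `(1 - η) ^ (m - 1)` and `(1 + η) ^ (m - 1)`
(`IsIrredStochastic.invariant_perturbation`). Hence the mean payoffs, which are the mean rewards
under the invariant distributions, differ at most by the factor `((1 + η) / (1 - η)) ^ (m - 1)`, and
this is less than `1 + ε` if `ε ≤ 1`. For `ε > 1` there is nothing to prove, since both mean payoffs
are in `[0, 1]`.
-/

/-! ### Irreducible stochastic matrices: invariant measures, mean payoff, perturbation -/

/-- `Q` is row-stochastic and its graph is strongly connected. -/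
structure IsIrredStochastic {ι : Type*} [Fintype ι] (Q : Matrix ι ι ℝ) : Prop where
  nonneg : ∀ i j, 0 ≤ Q i j
  row_sum : ∀ i, ∑ j, Q i j = 1
  conn : ∀ i j, Relation.ReflTransGen (fun a b => 0 < Q a b) i j

namespace IsIrredStochastic

variable {ι : Type*} [Fintype ι] {Q Q' : Matrix ι ι ℝ}

/-- A subinvariant vector is invariant, because the row sums are one. -/
lemma invariant_of_le (hQ : IsIrredStochastic Q) {x : ι → ℝ}
    (hx : ∀ j, x j ≤ ∑ i, x i * Q i j) (j : ι) : ∑ i, x i * Q i j = x j := by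
  have hs : ∑ j, x j = ∑ j, ∑ i, x i * Q i j := by
    rw [Finset.sum_comm]
    simp_rw [← Finset.mul_sum, hQ.row_sum, mul_one]
  exact ((Finset.sum_eq_sum_iff_of_le fun j _ => hx j).1 hs j (Finset.mem_univ j)).symm

lemma invariant_pos (hQ : IsIrredStochastic Q) {x : ι → ℝ} (h0 : ∀ i, 0 ≤ x i)
    (hx : ∀ j, ∑ i, x i * Q i j = x j) {i : ι} (hi : 0 < x i) (j : ι) : 0 < x j := by
  induction hQ.conn i j with
  | refl => exact hi
  | tail _ hbc ih =>
    rw [← hx]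
    exact Finset.sum_pos' (fun k _ => mul_nonneg (h0 k) (hQ.nonneg _ _))
      ⟨_, Finset.mem_univ _, mul_pos ih hbc⟩

/-- A left eigenvector `x` for the eigenvalue one exists as the right one does, and then `|x|` is
subinvariant, hence invariant. -/
lemma exists_invariant [Nonempty ι] (hQ : IsIrredStochastic Q) :
    ∃ ν : ι → ℝ, (∀ i, 0 < ν i) ∧ ∀ j, ∑ i, ν i * Q i j = ν j := by
  classical
  have hdet : (1 - Q).det = 0 := by
    rw [← Matrix.exists_mulVec_eq_zero_iff]
    refine ⟨fun _ => 1, fun h => one_ne_zero (congrFun h (Classical.arbitrary ι)), ?_⟩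
    ext i
    rw [Matrix.sub_mulVec, Matrix.one_mulVec]
    simp [Matrix.mulVec, dotProduct, hQ.row_sum]
  obtain ⟨x, hx0, hx⟩ := Matrix.exists_vecMul_eq_zero_iff.2 hdet
  have hxQ : ∀ j, ∑ i, x i * Q i j = x j := fun j => by
    have := congrFun hx j
    simp only [Matrix.vecMul_sub, Matrix.vecMul_one, Pi.sub_apply, Pi.zero_apply] at this
    have e : (Matrix.vecMul x Q) j = ∑ i, x i * Q i j := rfl
    linarith
  have habs : ∀ j, ∑ i, |x i| * Q i j = |x j| := hQ.invariant_of_le fun j => by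
    calc |x j| = |∑ i, x i * Q i j| := by rw [hxQ]
      _ ≤ ∑ i, |x i * Q i j| := Finset.abs_sum_le_sum_abs _ _
      _ = _ := by simp_rw [abs_mul, abs_of_nonneg (hQ.nonneg _ _)]
  obtain ⟨i, hi⟩ := Function.ne_iff.1 hx0
  exact ⟨fun i => |x i|, hQ.invariant_pos (fun i => abs_nonneg _) habs (abs_pos.2 hi), habs⟩

/-- Harmonic vectors are constant, by the maximum principle. -/
lemma harmonic_const (hQ : IsIrredStochastic Q) {h : ι → ℝ}
    (hh : ∀ i, ∑ j, Q i j * h j = h i) (i j : ι) : h i = h j := by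
  have : Nonempty ι := ⟨i⟩
  obtain ⟨m, hm⟩ := Finite.exists_max h
  have key : ∀ k, h k = h m := by
    intro k
    induction hQ.conn m k with
    | refl => rfl
    | @tail b c _ hbc ih =>
      have h1 : ∑ j, Q b j * (h m - h j) = 0 := by
        simp_rw [mul_sub, Finset.sum_sub_distrib, hh, ← Finset.sum_mul, hQ.row_sum, ih]
        ring
      have h2 := (Finset.sum_eq_zero_iff_of_nonneg
        (fun j _ => mul_nonneg (hQ.nonneg b j) (sub_nonneg.2 (hm j)))).1 h1 c (Finset.mem_univ c)
      rcases mul_eq_zero.1 h2 with h3 | h3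
      · exact absurd h3 hbc.ne'
      · linarith
  rw [key i, key j]

/-- The Poisson equation `r = (1 - Q) h + (ν r / ν 1) 1` is solvable: the linear map
`h ↦ (1 - Q) h + (ν h) 1` is injective, as harmonic vectors are constant. -/
lemma exists_poisson [Nonempty ι] (hQ : IsIrredStochastic Q) {ν : ι → ℝ} (hν : ∀ i, 0 < ν i)
    (hνQ : ∀ j, ∑ i, ν i * Q i j = ν j) (r : ι → ℝ) :
    ∃ h : ι → ℝ, ∀ i, r i = h i - Q.mulVec h i + (∑ j, ν j * r j) / ∑ j, ν j := by
  classical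
  have hpos : 0 < ∑ j, ν j := Finset.sum_pos (fun i _ => hν i) Finset.univ_nonempty
  have hinv : ∀ g : ι → ℝ, ∑ i, ν i * Q.mulVec g i = ∑ j, ν j * g j := by
    intro g
    simp_rw [Matrix.mulVec, dotProduct, Finset.mul_sum]
    rw [Finset.sum_comm]
    simp_rw [← mul_assoc, ← Finset.sum_mul, hνQ]
  let Φ : (ι → ℝ) →ₗ[ℝ] (ι → ℝ) :=
    { toFun := fun h i => h i - Q.mulVec h i + ∑ j, ν j * h j
      map_add' := by
        intro a b; ext i
        simp only [Matrix.mulVec_add, Pi.add_apply, mul_add, Finset.sum_add_distrib]; ring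
      map_smul' := by
        intro c a; ext i
        simp only [Matrix.mulVec_smul, Pi.smul_apply, smul_eq_mul, RingHom.id_apply, mul_add,
          mul_sub, Finset.mul_sum]
        congr 1
        exact Finset.sum_congr rfl fun _ _ => by ring }
  have hΦν : ∀ h, ∑ i, ν i * Φ h i = (∑ j, ν j * h j) * ∑ j, ν j := by
    intro h
    change ∑ i, ν i * (h i - Q.mulVec h i + ∑ j, ν j * h j) = _
    simp_rw [mul_add, mul_sub, Finset.sum_add_distrib, Finset.sum_sub_distrib, hinv,
      ← Finset.sum_mul]
    ring
  have hinj : Function.Injective Φ := by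
    rw [injective_iff_map_eq_zero]
    intro h h0
    have h1 : ∑ j, ν j * h j = 0 := by
      have := hΦν h
      simp only [h0, Pi.zero_apply, mul_zero, Finset.sum_const_zero] at this
      exact (mul_eq_zero.1 this.symm).resolve_right hpos.ne'
    have h2 : ∀ i, ∑ j, Q i j * h j = h i := fun i => by
      have h3 : h i - Q.mulVec h i + ∑ j, ν j * h j = 0 := congrFun h0 i
      have e : Q.mulVec h i = ∑ j, Q i j * h j := rfl
      linarith
    ext i
    have h4 : ∑ j, ν j * h j = (∑ j, ν j) * h i := by
      rw [Finset.sum_mul]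
      exact Finset.sum_congr rfl fun j _ => by rw [hQ.harmonic_const h2 j i]
    rw [h1] at h4
    exact (mul_eq_zero.1 h4.symm).resolve_left hpos.ne'
  obtain ⟨h, hh⟩ := (LinearMap.injective_iff_surjective.1 hinj) r
  refine ⟨h, fun i => ?_⟩
  have h5 := hΦν h
  rw [hh] at h5
  rw [h5, mul_div_assoc, div_self hpos.ne', mul_one]
  exact (congrFun hh i).symm

lemma abs_pow_mulVec_le [DecidableEq ι] (hQ : IsIrredStochastic Q) {h : ι → ℝ} {B : ℝ}
    (hB : ∀ i, |h i| ≤ B) (n : ℕ) (i : ι) : |(Q ^ n).mulVec h i| ≤ B := by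
  induction n generalizing i with
  | zero => simpa using hB i
  | succ n ih =>
    rw [pow_succ', ← Matrix.mulVec_mulVec]
    calc |∑ j, Q i j * (Q ^ n).mulVec h j| ≤ ∑ j, |Q i j * (Q ^ n).mulVec h j| :=
          Finset.abs_sum_le_sum_abs _ _
      _ ≤ ∑ j, Q i j * B := Finset.sum_le_sum fun j _ => by
          rw [abs_mul, abs_of_nonneg (hQ.nonneg i j)]
          exact mul_le_mul_of_nonneg_left (ih j) (hQ.nonneg i j)
      _ = B := by rw [← Finset.sum_mul, hQ.row_sum, one_mul]

/-- The averages of the rewards converge to the mean reward under the invariant distribution. -/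
lemma tendsto_average [DecidableEq ι] [Nonempty ι] (hQ : IsIrredStochastic Q) {ν : ι → ℝ}
    (hν : ∀ i, 0 < ν i) (hνQ : ∀ j, ∑ i, ν i * Q i j = ν j) (r : ι → ℝ) (s : ι) :
    Tendsto (fun n : ℕ => (1 / (n : ℝ)) * ∑ i ∈ Finset.range n, (Q ^ i).mulVec r s) atTop
      (𝓝 ((∑ j, ν j * r j) / ∑ j, ν j)) := by
  obtain ⟨h, hh⟩ := hQ.exists_poisson hν hνQ r
  set x := (∑ j, ν j * r j) / ∑ j, ν j
  have hr : r = (h - Q.mulVec h) + x • (fun _ => 1) := by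
    ext i; simpa using hh i
  have hone : ∀ n : ℕ, (Q ^ n).mulVec (fun _ => (1 : ℝ)) = fun _ => 1 := by
    intro n
    induction n with
    | zero => simp
    | succ n ih =>
      rw [pow_succ, ← Matrix.mulVec_mulVec]
      have : Q.mulVec (fun _ => (1 : ℝ)) = fun _ => 1 := by
        ext i; simp [Matrix.mulVec, dotProduct, hQ.row_sum]
      rw [this, ih]
  have hterm : ∀ i, (Q ^ i).mulVec r s =
      (Q ^ i).mulVec h s - (Q ^ (i + 1)).mulVec h s + x := by
    intro i
    rw [hr, Matrix.mulVec_add, Matrix.mulVec_sub, Matrix.mulVec_mulVec, ← pow_succ,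
      Matrix.mulVec_smul, hone]
    simp
  have hsum : ∀ n : ℕ, ∑ i ∈ Finset.range n, (Q ^ i).mulVec r s =
      h s - (Q ^ n).mulVec h s + n * x := by
    intro n
    simp_rw [hterm, Finset.sum_add_distrib, Finset.sum_range_sub' (fun i => (Q ^ i).mulVec h s)]
    simp
  obtain ⟨m, hm⟩ := Finite.exists_max (fun i => |h i|)
  have hz : Tendsto (fun n : ℕ => (1 / (n : ℝ)) * (h s - (Q ^ n).mulVec h s)) atTop (𝓝 0) := by
    refine Tendsto.zero_mul_isBoundedUnder_le tendsto_one_div_atTop_nhds_zero_nat ?_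
    refine isBoundedUnder_of ⟨|h m| + |h m|, fun n => ?_⟩
    exact (norm_sub_le _ _).trans (add_le_add (hm s) (hQ.abs_pow_mulVec_le hm n s))
  have hlim : Tendsto (fun n : ℕ => (1 / (n : ℝ)) * (h s - (Q ^ n).mulVec h s) + x) atTop
      (𝓝 x) := by simpa using hz.add_const x
  refine hlim.congr' ?_
  filter_upwards [eventually_gt_atTop 0] with n hn
  rw [hsum]
  have : (n : ℝ) ≠ 0 := by positivity
  field_simp

/-- A maximum principle: a solution `d` of `d = b + d Q` off the state `u`, with `b ≥ 0` and
`d u = 0`, is non-negative. -/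
lemma nonneg_of_supersolution (hQ : IsIrredStochastic Q) {d : ι → ℝ} {u : ι} (hu : d u = 0)
    (hd : ∀ s, s ≠ u → ∑ t, d t * Q t s ≤ d s) (s : ι) : 0 ≤ d s := by
  have hle : ∀ s, (d s)⁻ ≤ ∑ t, (d t)⁻ * Q t s := by
    intro s
    have hnn : 0 ≤ ∑ t, (d t)⁻ * Q t s :=
      Finset.sum_nonneg fun t _ => mul_nonneg (negPart_nonneg _) (hQ.nonneg _ _)
    by_cases hs : s = u
    · rw [hs, hu]; simpa [hs] using hnn
    · rw [negPart_def]
      refine sup_le ?_ hnn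
      calc -d s ≤ -∑ t, d t * Q t s := neg_le_neg (hd s hs)
        _ = ∑ t, (-d t) * Q t s := by simp [Finset.sum_neg_distrib]
        _ ≤ _ := Finset.sum_le_sum fun t _ =>
          mul_le_mul_of_nonneg_right (neg_le_negPart _) (hQ.nonneg _ _)
  have hinv := hQ.invariant_of_le hle
  by_contra hs
  have h1 : 0 < (d s)⁻ := by
    rw [negPart_def]; exact lt_sup_of_lt_left (by linarith)
  have := hQ.invariant_pos (fun i => negPart_nonneg (d i)) hinv h1 u
  simp [hu] at this

/-- Changing the row `u` by a relative error of at most `η` changes the invariant measure, scaled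
to keep its value at `u`, by a relative error of at most `η`. -/
lemma invariant_row_change [Nonempty ι] (hQ : IsIrredStochastic Q) (hQ' : IsIrredStochastic Q')
    {u : ι} (hrow : ∀ s, s ≠ u → ∀ t, Q' s t = Q s t) {η : ℝ}
    (hlo : ∀ t, (1 - η) * Q u t ≤ Q' u t) (hhi : ∀ t, Q' u t ≤ (1 + η) * Q u t)
    {ν : ι → ℝ} (hν : ∀ i, 0 < ν i) (hνQ : ∀ j, ∑ i, ν i * Q i j = ν j) :
    ∃ ν' : ι → ℝ, (∀ i, 0 < ν' i) ∧ (∀ j, ∑ i, ν' i * Q' i j = ν' j) ∧ ν' u = ν u ∧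
      ∀ s, s ≠ u → (1 - η) * ν s ≤ ν' s ∧ ν' s ≤ (1 + η) * ν s := by
  classical
  obtain ⟨x, hx, hxQ⟩ := hQ'.exists_invariant
  obtain ⟨ν', hdef⟩ : ∃ ν' : ι → ℝ, ∀ i, ν' i = ν u / x u * x i := ⟨_, fun _ => rfl⟩
  have hc : 0 < ν u / x u := div_pos (hν u) (hx u)
  have hν'Q : ∀ j, ∑ i, ν' i * Q' i j = ν' j := fun j => by
    simp_rw [hdef, mul_assoc, ← Finset.mul_sum, hxQ]
  have hu : ν' u = ν u := by rw [hdef, div_mul_cancel₀ _ (hx u).ne']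
  -- both bounds are the maximum principle for a combination of `ν` and `ν'` vanishing at `u`
  have hcomb : ∀ a b : ℝ, (∀ t, 0 ≤ a * Q u t + b * Q' u t) →
      ∀ s, s ≠ u → 0 ≤ a * ν s + b * ν' s := by
    intro a b hle s hs
    have h := hQ.nonneg_of_supersolution (u := u)
      (d := fun s => if s = u then 0 else a * ν s + b * ν' s) (by simp) ?_ s
    · simpa [hs] using h
    intro s hs
    simp only [hs, if_false]
    rw [← hνQ s, ← hν'Q s, Finset.mul_sum, Finset.mul_sum, ← Finset.sum_add_distrib,
      ← Finset.add_sum_erase _ _ (Finset.mem_univ u),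
      ← Finset.add_sum_erase (a := u) _ _ (Finset.mem_univ u)]
    refine add_le_add ?_ (Finset.sum_le_sum fun t ht => ?_)
    · rw [hu, if_pos rfl, zero_mul]
      have := mul_nonneg (hν u).le (hle s)
      linarith
    · have ht := Finset.ne_of_mem_erase ht
      rw [if_neg ht, hrow t ht]
      exact le_of_eq (by ring)
  refine ⟨ν', fun i => by rw [hdef]; exact mul_pos hc (hx i), hν'Q, hu, fun s hs => ⟨?_, ?_⟩⟩
  · have := hcomb (-(1 - η)) 1 (fun t => by linarith [hlo t]) s hs
    linarith
  · have := hcomb (1 + η) (-1) (fun t => by linarith [hhi t]) s hs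
    linarith

/-- If the rows in `U` of `Q` are replaced by those of `Q'`, which approximates `Q` with relative
error `η`, the entry at `s` of the invariant measure, suitably scaled, takes on the relative error
`η` once for each row in `U` other than `s`. This is the estimate that the Markov
chain tree theorem gives; it is obtained by changing one row at a time. -/
lemma invariant_perturbation [Nonempty ι] [DecidableEq ι] (hQ : IsIrredStochastic Q)
    (hQ' : IsIrredStochastic Q') {η : ℝ} (h0 : 0 ≤ η) (h1 : η < 1)
    (hlo : ∀ s t, (1 - η) * Q s t ≤ Q' s t) (hhi : ∀ s t, Q' s t ≤ (1 + η) * Q s t)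
    {ν : ι → ℝ} (hν : ∀ i, 0 < ν i) (hνQ : ∀ j, ∑ i, ν i * Q i j = ν j) (U : Finset ι) :
    ∃ ν' : ι → ℝ, (∀ i, 0 < ν' i) ∧
      (∀ j, ∑ i, ν' i * (if i ∈ U then Q' i j else Q i j) = ν' j) ∧
      ∀ s, (1 - η) ^ (U.erase s).card * ν s ≤ ν' s ∧ ν' s ≤ (1 + η) ^ (U.erase s).card * ν s := by
  have hmix : ∀ U : Finset ι, IsIrredStochastic
      (fun i j => if i ∈ U then Q' i j else Q i j : Matrix ι ι ℝ) := by
    intro U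
    refine ⟨fun i j => ?_, fun i => ?_, fun i j => ?_⟩
    · split_ifs
      exacts [hQ'.nonneg i j, hQ.nonneg i j]
    · split_ifs
      exacts [hQ'.row_sum i, hQ.row_sum i]
    · refine Relation.ReflTransGen.mono (fun a b hab => ?_) i j (hQ.conn i j)
      split_ifs
      exacts [(mul_pos (by linarith) hab).trans_le (hlo a b), hab]
  induction U using Finset.induction_on with
  | empty => exact ⟨ν, hν, by simpa using hνQ, by simp⟩
  | insert u U hu ih =>
    obtain ⟨ν₁, hp, hinv, hb⟩ := ih
    obtain ⟨ν₂, hp₂, hinv₂, hu₂, hb₂⟩ := (hmix U).invariant_row_change (hmix (insert u U)) (u := u)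
      (fun s hs t => by simp [hs]) (η := η) (fun t => by simpa [hu] using hlo u t)
      (fun t => by simpa [hu] using hhi u t) hp hinv
    refine ⟨ν₂, hp₂, hinv₂, fun s => ?_⟩
    by_cases hs : s = u
    · subst hs
      rw [Finset.erase_insert hu, hu₂]
      simpa [Finset.erase_eq_of_notMem hu] using hb s
    · have hc : ((insert u U).erase s).card = (U.erase s).card + 1 := by
        rw [Finset.erase_insert_of_ne (Ne.symm hs),
          Finset.card_insert_of_notMem (fun h => hu (Finset.mem_of_mem_erase h))]
      rw [hc, pow_succ', pow_succ', mul_assoc, mul_assoc]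
      exact ⟨(mul_le_mul_of_nonneg_left (hb s).1 (by linarith)).trans (hb₂ s hs).1,
        (hb₂ s hs).2.trans (mul_le_mul_of_nonneg_left (hb s).2 (by linarith))⟩

/-- If `ν' s / ν s` varies at most between `L` and `U`, the mean for the weights `ν'` is at most
`U / L` times the mean for the weights `ν`. -/
lemma weighted_mean_le [Nonempty ι] {ν ν' r : ι → ℝ} {L U : ℝ} (hL : 0 < L)
    (hν : ∀ i, 0 < ν i) (hr : ∀ i, 0 ≤ r i)
    (hlo : ∀ s, L * ν s ≤ ν' s) (hhi : ∀ s, ν' s ≤ U * ν s) :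
    (∑ j, ν' j * r j) / ∑ j, ν' j ≤ U / L * ((∑ j, ν j * r j) / ∑ j, ν j) := by
  have hpos : 0 < ∑ j, ν j := Finset.sum_pos (fun i _ => hν i) Finset.univ_nonempty
  have h1 : ∑ j, ν' j * r j ≤ U * ∑ j, ν j * r j := by
    rw [Finset.mul_sum]
    exact Finset.sum_le_sum fun j _ => by
      rw [← mul_assoc]; exact mul_le_mul_of_nonneg_right (hhi j) (hr j)
  have h2 : L * ∑ j, ν j ≤ ∑ j, ν' j := by
    rw [Finset.mul_sum]; exact Finset.sum_le_sum fun j _ => hlo j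
  have h3 : 0 ≤ ∑ j, ν' j * r j := Finset.sum_nonneg fun j _ =>
    mul_nonneg ((mul_pos hL (hν j)).le.trans (hlo j)) (hr j)
  rw [div_mul_div_comm]
  exact div_le_div₀ (h3.trans h1) h1 (mul_pos hL hpos) h2

lemma weighted_mean_mem_Icc [Nonempty ι] {ν r : ι → ℝ} (hν : ∀ i, 0 < ν i)
    (hr : ∀ i, r i ∈ Set.Icc (0 : ℝ) 1) :
    (∑ j, ν j * r j) / ∑ j, ν j ∈ Set.Icc (0 : ℝ) 1 := by
  have hpos : 0 < ∑ j, ν j := Finset.sum_pos (fun i _ => hν i) Finset.univ_nonempty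
  refine ⟨div_nonneg (Finset.sum_nonneg fun j _ => mul_nonneg (hν j).le (hr j).1) hpos.le, ?_⟩
  rw [div_le_one hpos]
  exact Finset.sum_le_sum fun j _ => mul_le_of_le_one_right (hν j).le (hr j).2

/-- For `ε ≤ 1`, the factor `((1 + η) / (1 - η)) ^ (m - 1)` is less than `(1 + η) ^ (2 m)`. -/
lemma perturbation_factor_lt {η ε : ℝ} (h0 : 0 < η) (hε : ε ≤ 1) {k : ℕ}
    (hη : (1 + η) ^ (2 * (k + 1)) = 1 + ε) :
    η < 1 ∧ (1 + η) ^ k / (1 - η) ^ k < 1 + ε := by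
  have hb : 2 * (k + 1) * η ≤ 1 := by
    have := one_add_mul_le_pow (a := η) (by linarith) (2 * (k + 1))
    push_cast at this
    linarith
  have hk : (0 : ℝ) ≤ k := Nat.cast_nonneg k
  have h1 : η ≤ 1 / 2 := by nlinarith [mul_nonneg hk h0.le]
  refine ⟨by linarith, ?_⟩
  have hlow : (0 : ℝ) < 1 - η := by linarith
  rw [div_lt_iff₀ (pow_pos hlow k), ← hη]
  have h2 : 1 - η / 2 ≤ (1 - η ^ 2) ^ k := by
    have := one_add_mul_le_pow (a := -η ^ 2) (by nlinarith) k
    have h3 : (k : ℝ) * η ^ 2 ≤ η / 2 := by nlinarith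
    calc 1 - η / 2 ≤ 1 + (k : ℝ) * (-η ^ 2) := by linarith
      _ ≤ _ := this
      _ = _ := by ring
  have h4 : 1 < (1 + η) ^ 2 * (1 - η ^ 2) ^ k :=
    calc 1 < (1 + η) ^ 2 * (1 - η / 2) := by nlinarith
      _ ≤ _ := mul_le_mul_of_nonneg_left h2 (by positivity)
  calc (1 + η) ^ k < (1 + η) ^ k * ((1 + η) ^ 2 * (1 - η ^ 2) ^ k) :=
        lt_mul_of_one_lt_right (by positivity) h4
    _ = (1 + η) ^ (2 * (k + 1)) * (1 - η) ^ k := by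
        rw [show 1 - η ^ 2 = (1 + η) * (1 - η) by ring, mul_pow]; ring

/-- The mean payoffs of two irreducible chains on `m` states exist. They differ by less than `ε` if
the transition probabilities differ by a relative error of at most `(1 + ε) ^ (1 / (2 m)) - 1`. -/
lemma exists_averages_close [Nonempty ι] [DecidableEq ι] (hQ : IsIrredStochastic Q)
    (hQ' : IsIrredStochastic Q') {ε η : ℝ} (h0 : 0 < η)
    (hη : (1 + η) ^ (2 * Fintype.card ι) = 1 + ε)
    (hd : ∀ s t, |Q' s t - Q s t| ≤ η * Q s t)
    {r : ι → ℝ} (hr : ∀ i, r i ∈ Set.Icc (0 : ℝ) 1) :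
    ∃ x' x : ℝ,
      (∀ s, Tendsto (fun n : ℕ => (1 / (n : ℝ)) * ∑ i ∈ Finset.range n, (Q' ^ i).mulVec r s) atTop
        (𝓝 x')) ∧
      (∀ s, Tendsto (fun n : ℕ => (1 / (n : ℝ)) * ∑ i ∈ Finset.range n, (Q ^ i).mulVec r s) atTop
        (𝓝 x)) ∧ |x' - x| < ε := by
  obtain ⟨ν, hν, hνQ⟩ := hQ.exists_invariant
  have hx := weighted_mean_mem_Icc hν hr
  rcases lt_or_ge 1 ε with hε | hε
  · obtain ⟨ν', hν', hνQ'⟩ := hQ'.exists_invariant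
    have hx' := weighted_mean_mem_Icc hν' hr
    refine ⟨_, _, hQ'.tendsto_average hν' hνQ' r, hQ.tendsto_average hν hνQ r, ?_⟩
    rw [abs_lt]
    constructor <;> linarith [hx.1, hx.2, hx'.1, hx'.2]
  · obtain ⟨k, hk⟩ : ∃ k, Fintype.card ι = k + 1 := ⟨_, (Nat.succ_pred Fintype.card_ne_zero).symm⟩
    rw [hk] at hη
    obtain ⟨hη1, hR⟩ := perturbation_factor_lt h0 hε hη
    obtain ⟨ν', hν', hνQ', hb⟩ := hQ.invariant_perturbation hQ' h0.le hη1
      (fun s t => by linarith [(abs_le.1 (hd s t)).1])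
      (fun s t => by linarith [(abs_le.1 (hd s t)).2]) hν hνQ Finset.univ
    simp only [Finset.mem_univ, if_true] at hνQ'
    have hb' : ∀ s, (1 - η) ^ k * ν s ≤ ν' s ∧ ν' s ≤ (1 + η) ^ k * ν s := fun s => by
      have := hb s
      rwa [Finset.card_erase_of_mem (Finset.mem_univ s), Finset.card_univ, hk,
        Nat.add_sub_cancel] at this
    have hx' := weighted_mean_mem_Icc hν' hr
    refine ⟨_, _, hQ'.tendsto_average hν' hνQ' r, hQ.tendsto_average hν hνQ r, ?_⟩
    have hL : 0 < (1 - η) ^ k := pow_pos (by linarith) k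
    have hU : 0 < (1 + η) ^ k := pow_pos (by linarith) k
    have h1 := weighted_mean_le hL hν (fun i => (hr i).1) (fun s => (hb' s).1) fun s => (hb' s).2
    -- exchanging `ν` and `ν'` inverts the bounds, with the same quotient
    have h2 := weighted_mean_le (inv_pos.2 hU) hν' (fun i => (hr i).1)
      (fun s => (inv_mul_le_iff₀ hU).2 (hb' s).2)
      (fun s => (le_inv_mul_iff₀ hL).2 (hb' s).1)
    rw [show ((1 - η) ^ k)⁻¹ / ((1 + η) ^ k)⁻¹ = (1 + η) ^ k / (1 - η) ^ k by
      rw [inv_div_inv]] at h2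
    set R := (1 + η) ^ k / (1 - η) ^ k
    have hR1 : 1 ≤ R := by
      rw [one_le_div hL]
      exact pow_le_pow_left₀ (by linarith) (by linarith) k
    rw [abs_lt]
    constructor
    · nlinarith [mul_le_of_le_one_right (sub_nonneg.2 hR1) hx'.2]
    · nlinarith [mul_le_of_le_one_right (sub_nonneg.2 hR1) hx.2]

end IsIrredStochastic

/-- The rows of `Q` in `C` are the transition probabilities of an irreducible chain on `C`. -/
structure IsIrredOn {S : Type*} (Q : Matrix S S ℝ) (C : Finset S) : Prop where
  closed : ∀ s ∈ C, ∀ t, t ∉ C → Q s t = 0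
  irred : IsIrredStochastic (Q.submatrix (Subtype.val : C → S) Subtype.val)

lemma IsIrredOn.pow_mulVec {S : Type*} [Fintype S] [DecidableEq S] {Q : Matrix S S ℝ}
    {C : Finset S} (hQ : IsIrredOn Q C) (r : S → ℝ) (i : ℕ) (s : C) :
    (Q ^ i).mulVec r s =
      ((Q.submatrix (Subtype.val : C → S) Subtype.val) ^ i).mulVec (fun t : C => r t) s := by
  induction i generalizing s with
  | zero => simp
  | succ i ih =>
    rw [pow_succ', pow_succ', ← Matrix.mulVec_mulVec, ← Matrix.mulVec_mulVec]
    simp only [Matrix.mulVec, dotProduct] at ih ⊢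
    rw [← Finset.sum_subset (Finset.subset_univ C)
      (fun t _ ht => by rw [hQ.closed s s.2 t ht, zero_mul]), ← Finset.sum_coe_sort]
    exact Finset.sum_congr rfl fun t _ => by rw [ih t]; rfl

/-- Mean payoffs on `C` under an approximation `Q'` of `Q` with relative error at most
`(1 + ε) ^ (1 / (2 |C|)) - 1` exist and differ by less than `ε`. -/
lemma exists_hasMeanPayoff_close {S : Type*} [Fintype S] [DecidableEq S] {Q Q' : Matrix S S ℝ}
    {C : Finset S} (hC : C.Nonempty) (hQ : IsIrredOn Q C) (hQ' : IsIrredOn Q' C) {ε : ℝ}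
    (hε : 0 < ε)
    (hd : ∀ s ∈ C, ∀ t ∈ C,
      |Q' s t - Q s t| ≤ ((1 + ε) ^ (1 / (2 * (C.card : ℝ))) - 1) * Q s t)
    {r : S → ℝ} (hr : ∀ i, r i ∈ Set.Icc (0 : ℝ) 1) :
    ∃ x' x : ℝ, HasMeanPayoff Q' r C x' ∧ HasMeanPayoff Q r C x ∧ |x' - x| < ε := by
  have : Nonempty C := hC.to_subtype
  have hm : (0 : ℝ) < C.card := Nat.cast_pos.2 hC.card_pos
  have h0 : 0 < (1 + ε) ^ (1 / (2 * (C.card : ℝ))) - 1 :=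
    sub_pos.2 (Real.one_lt_rpow (by linarith) (by positivity))
  have hη : (1 + ((1 + ε) ^ (1 / (2 * (C.card : ℝ))) - 1)) ^ (2 * Fintype.card C) = 1 + ε := by
    rw [add_sub_cancel, ← Real.rpow_natCast, ← Real.rpow_mul (by linarith), Fintype.card_coe]
    push_cast
    rw [one_div_mul_cancel (by positivity), Real.rpow_one]
  obtain ⟨x', x, h1, h2, h3⟩ := hQ.irred.exists_averages_close hQ'.irred h0 hη
    (fun s t => hd s s.2 t t.2) (r := fun s : C => r s) (fun s => hr s)
  refine ⟨x', x, fun s hs => ?_, fun s hs => ?_, h3⟩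
  · simpa only [← hQ'.pow_mulVec r _ ⟨s, hs⟩] using h1 ⟨s, hs⟩
  · simpa only [← hQ.pow_mulVec r _ ⟨s, hs⟩] using h2 ⟨s, hs⟩

/-! ### Maximal inequalities and almost sure properties of runs -/

lemma prod_ite_eq_pow_count {b : ℝ} (p : ℕ → Prop) [DecidablePred p] (m : ℕ) :
    ∏ j ∈ Finset.range m, (if p j then b else 1) = b ^ Nat.count p m := by
  induction m with
  | zero => simp
  | succ m ih => rw [Finset.prod_range_succ, ih, Nat.count_succ]; split_ifs <;> simp [pow_succ]

namespace MarkovChain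

lemma P_le_one {S : Type*} [Fintype S] (M : MarkovChain S) (s t : S) : M.P s t ≤ 1 := by
  rw [← M.P_sum s]
  exact Finset.single_le_sum (fun t _ => M.P_nonneg s t) (Finset.mem_univ t)

lemma sum_avoid {S : Type*} [Fintype S] [DecidableEq S] (M : MarkovChain S) (s t : S) (b : ℝ) :
    ∑ v, M.P s v * (if v = t then 0 else b) = (1 - M.P s t) * b := by
  have : ∀ v, M.P s v * (if v = t then 0 else b) = M.P s v * b - if v = t then M.P s v * b else 0 :=
    fun v => by split_ifs <;> ring
  simp_rw [this, Finset.sum_sub_distrib, ← Finset.sum_mul, M.P_sum]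
  simp
  ring

variable {S : Type*} [Fintype S] [MeasurableSpace S] [DiscreteMeasurableSpace S]

lemma measurableSet_cone (a : ℕ → S) (n : ℕ) : MeasurableSet {ρ : ℕ → S | ∀ i ≤ n, ρ i = a i} := by
  have : {ρ : ℕ → S | ∀ i ≤ n, ρ i = a i} = ⋂ i ∈ Set.Iic n, {ρ | ρ i = a i} := by
    ext; simp
  rw [this]
  exact MeasurableSet.biInter (Set.to_countable _) fun i _ =>
    measurableSet_eq_fun (measurable_pi_apply i) measurable_const

lemma runMeasure_cone_step (M : MarkovChain S) (a : ℕ → S) (n : ℕ) (t : S) :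
    M.runMeasure {ρ | ∀ i ≤ n + 1, ρ i = Function.update a (n + 1) t i} =
      M.runMeasure {ρ | ∀ i ≤ n, ρ i = a i} * ENNReal.ofReal (M.P (a n) t) := by
  rw [M.runMeasure_cone, M.runMeasure_cone, ← ENNReal.ofReal_mul
    (mul_nonneg (M.μ_nonneg _) (Finset.prod_nonneg fun i _ => M.P_nonneg _ _)),
    Finset.prod_range_succ]
  have h : ∀ i ≤ n, Function.update a (n + 1) t i = a i := fun i hi =>
    Function.update_of_ne (by omega) _ _
  rw [h 0 (by omega), h n le_rfl, Function.update_self, mul_assoc]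
  congr 3
  refine Finset.prod_congr rfl fun i hi => ?_
  have := Finset.mem_range.1 hi
  rw [h i (by omega), h (i + 1) (by omega)]

/-- The maximal inequality up to a finite horizon, by induction on the horizon: after a first step
with factor `f (a n) t` the remaining product has to reach `x / f (a n) t`. -/
lemma maximal_inequality_finite (M : MarkovChain S) {f : S → S → ℝ} (hf0 : ∀ s t, 0 ≤ f s t)
    (hf : ∀ s, ∑ t, M.P s t * f s t ≤ 1) (N n : ℕ) (a : ℕ → S) {x : ℝ} (hx : 0 < x) :
    M.runMeasure {ρ | (∀ i ≤ n, ρ i = a i) ∧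
        ∃ m ≤ N, x ≤ ∏ j ∈ Finset.range m, f (ρ (n + j)) (ρ (n + j + 1))} ≤
      M.runMeasure {ρ | ∀ i ≤ n, ρ i = a i} * ENNReal.ofReal x⁻¹ := by
  classical
  rcases le_or_gt x 1 with h1 | h1
  · refine (measure_mono fun ρ h => h.1).trans (le_mul_of_one_le_right' ?_)
    exact ENNReal.one_le_ofReal.2 ((one_le_inv₀ hx).2 h1)
  induction N generalizing n a x with
  | zero =>
    refine le_of_eq_of_le (measure_mono_null (t := ∅) ?_ measure_empty) zero_le
    rintro ρ ⟨-, m, hm, h⟩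
    obtain rfl : m = 0 := by omega
    exact absurd h (by simpa using h1)
  | succ N ih =>
    have hsub : {ρ : ℕ → S | (∀ i ≤ n, ρ i = a i) ∧
        ∃ m ≤ N + 1, x ≤ ∏ j ∈ Finset.range m, f (ρ (n + j)) (ρ (n + j + 1))} ⊆
        ⋃ t ∈ (Finset.univ : Finset S),
          {ρ | (∀ i ≤ n + 1, ρ i = Function.update a (n + 1) t i) ∧
            ∃ m ≤ N, x ≤ f (a n) t *
              ∏ j ∈ Finset.range m, f (ρ (n + 1 + j)) (ρ (n + 1 + j + 1))} := by
      rintro ρ ⟨hρ, m, hm, h⟩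
      simp only [Finset.mem_univ, Set.iUnion_true, Set.mem_iUnion]
      refine ⟨ρ (n + 1), fun i hi => ?_, ?_⟩
      · rcases Nat.lt_or_ge n i with h | h
        · obtain rfl : i = n + 1 := by omega
          simp
        · rw [Function.update_of_ne (by omega), hρ i h]
      · cases m with
        | zero => exact absurd h (by simpa using h1)
        | succ m =>
          refine ⟨m, by omega, ?_⟩
          rw [Finset.prod_range_succ'] at h
          rw [← hρ n le_rfl, mul_comm]
          simpa [Nat.add_assoc, Nat.add_comm 1] using h
    refine (measure_mono hsub).trans ((measure_biUnion_finset_le _ _).trans ?_)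
    have hterm : ∀ t, M.runMeasure
          {ρ | (∀ i ≤ n + 1, ρ i = Function.update a (n + 1) t i) ∧
            ∃ m ≤ N, x ≤ f (a n) t *
              ∏ j ∈ Finset.range m, f (ρ (n + 1 + j)) (ρ (n + 1 + j + 1))} ≤
        M.runMeasure {ρ | ∀ i ≤ n, ρ i = a i} *
          ENNReal.ofReal (M.P (a n) t * f (a n) t * x⁻¹) := by
      intro t
      rcases (hf0 (a n) t).eq_or_lt with h0 | h0
      · refine le_of_eq_of_le (measure_mono_null (t := ∅) ?_ measure_empty) zero_le
        rintro ρ ⟨-, m, hm, h⟩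
        rw [← h0, zero_mul] at h
        exact absurd h (not_le.2 hx)
      · have hxt : 0 < x / f (a n) t := div_pos hx h0
        have hset : {ρ : ℕ → S | (∀ i ≤ n + 1, ρ i = Function.update a (n + 1) t i) ∧
            ∃ m ≤ N, x ≤ f (a n) t *
              ∏ j ∈ Finset.range m, f (ρ (n + 1 + j)) (ρ (n + 1 + j + 1))} =
            {ρ | (∀ i ≤ n + 1, ρ i = Function.update a (n + 1) t i) ∧
            ∃ m ≤ N, x / f (a n) t ≤
              ∏ j ∈ Finset.range m, f (ρ (n + 1 + j)) (ρ (n + 1 + j + 1))} := by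
          ext ρ
          simp only [Set.mem_ofPred_eq, div_le_iff₀' h0]
        have hstep : M.runMeasure {ρ | (∀ i ≤ n + 1, ρ i = Function.update a (n + 1) t i) ∧
            ∃ m ≤ N, x / f (a n) t ≤
              ∏ j ∈ Finset.range m, f (ρ (n + 1 + j)) (ρ (n + 1 + j + 1))} ≤
            M.runMeasure {ρ | ∀ i ≤ n + 1, ρ i = Function.update a (n + 1) t i} *
              ENNReal.ofReal (x / f (a n) t)⁻¹ := by
          rcases le_or_gt (x / f (a n) t) 1 with h2 | h2
          · refine (measure_mono fun ρ h => h.1).trans (le_mul_of_one_le_right' ?_)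
            exact ENNReal.one_le_ofReal.2 ((one_le_inv₀ hxt).2 h2)
          · exact ih (n + 1) _ hxt h2
        rw [hset]
        refine hstep.trans (le_of_eq ?_)
        rw [runMeasure_cone_step, mul_assoc, ← ENNReal.ofReal_mul (M.P_nonneg _ _), inv_div,
          div_eq_mul_inv, mul_assoc]
    refine (Finset.sum_le_sum fun t _ => hterm t).trans ?_
    rw [← Finset.mul_sum, ← ENNReal.ofReal_sum_of_nonneg (fun t _ => mul_nonneg
      (mul_nonneg (M.P_nonneg _ _) (hf0 _ _)) (inv_nonneg.2 hx.le)), ← Finset.sum_mul]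
    gcongr
    exact mul_le_of_le_one_left (inv_nonneg.2 hx.le) (hf _)

/-- Ville's maximal inequality for the multiplicative supermartingale
`∏ j < m, f (ρ (n + j)) (ρ (n + j + 1))` after the path `a 0 ⋯ a n`. -/
theorem maximal_inequality (M : MarkovChain S) {f : S → S → ℝ} (hf0 : ∀ s t, 0 ≤ f s t)
    (hf : ∀ s, ∑ t, M.P s t * f s t ≤ 1) (n : ℕ) (a : ℕ → S) {x : ℝ} (hx : 0 < x) :
    M.runMeasure {ρ | (∀ i ≤ n, ρ i = a i) ∧
        ∃ m, x ≤ ∏ j ∈ Finset.range m, f (ρ (n + j)) (ρ (n + j + 1))} ≤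
      M.runMeasure {ρ | ∀ i ≤ n, ρ i = a i} * ENNReal.ofReal x⁻¹ := by
  have hU : {ρ : ℕ → S | (∀ i ≤ n, ρ i = a i) ∧
      ∃ m, x ≤ ∏ j ∈ Finset.range m, f (ρ (n + j)) (ρ (n + j + 1))} =
      ⋃ N : ℕ, {ρ | (∀ i ≤ n, ρ i = a i) ∧
        ∃ m ≤ N, x ≤ ∏ j ∈ Finset.range m, f (ρ (n + j)) (ρ (n + j + 1))} := by
    ext ρ
    simp only [Set.mem_ofPred_eq, Set.mem_iUnion, exists_and_left, and_congr_right_iff]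
    exact fun _ => ⟨fun ⟨m, h⟩ => ⟨m, m, le_rfl, h⟩, fun ⟨_, m, _, h⟩ => ⟨m, h⟩⟩
  rw [hU, Monotone.measure_iUnion]
  · exact iSup_le fun N => M.maximal_inequality_finite hf0 hf N n a hx
  · rintro N N' hN ρ ⟨h1, m, hm, h2⟩
    exact ⟨h1, m, hm.trans hN, h2⟩

/-- A form of the strong Markov property: the property `B n ρ` depends on `ρ 0, …, ρ n` only. If
every run of `E` has it at some time, and `E` has conditional probability at most `c` given the
path up to the first such time, then `E` has probability at most `c`. -/
theorem runMeasure_le_of_first_time (M : MarkovChain S) {B : ℕ → (ℕ → S) → Prop}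
    (hB : ∀ n ρ ρ', (∀ i ≤ n, ρ' i = ρ i) → B n ρ → B n ρ') {E : Set (ℕ → S)} {c : ENNReal}
    (hfinite : ∀ ρ ∈ E, ∃ n, B n ρ)
    (hE : ∀ n a, B n a → (∀ m < n, ¬ B m a) →
      M.runMeasure ({ρ | ∀ i ≤ n, ρ i = a i} ∩ E) ≤ M.runMeasure {ρ | ∀ i ≤ n, ρ i = a i} * c) :
    M.runMeasure E ≤ c := by
  classical
  let F : ℕ → Set (ℕ → S) := fun n => {ρ | B n ρ ∧ ∀ m < n, ¬ B m ρ}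
  have hF : ∀ n ρ ρ', (∀ i ≤ n, ρ' i = ρ i) → ρ ∈ F n → ρ' ∈ F n := fun n ρ ρ' h hρ =>
    ⟨hB n ρ ρ' h hρ.1, fun m hm hm' => hρ.2 m hm
      (hB m ρ' ρ (fun i hi => (h i (by omega)).symm) hm')⟩
  -- `F n` is the finite disjoint union of the cones of the paths `a 0 ⋯ a n` with `a ∈ F n`
  let e : ∀ n, (Fin (n + 1) → S) → ℕ → S := fun n y i => y (Fin.ofNat (n + 1) i)
  let Y : ∀ n, Finset (Fin (n + 1) → S) := fun n => Finset.univ.filter fun y => e n y ∈ F n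
  have he : ∀ n (ρ : ℕ → S), ∀ i ≤ n, e n (fun j => ρ j) i = ρ i := fun n ρ i hi => by
    simp [e, Fin.ofNat, Nat.mod_eq_of_lt (Nat.lt_succ_of_le hi)]
  have hcover : ∀ n, F n = ⋃ y ∈ Y n, {ρ : ℕ → S | ∀ i ≤ n, ρ i = e n y i} := by
    intro n
    ext ρ
    simp only [Set.mem_iUnion, exists_prop]
    constructor
    · intro h
      refine ⟨fun j => ρ j, ?_, fun i hi => (he n ρ i hi).symm⟩
      exact Finset.mem_filter.2 ⟨Finset.mem_univ _, hF n ρ _ (he n ρ) h⟩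
    · rintro ⟨y, hy, h⟩
      exact hF n _ ρ h (Finset.mem_filter.1 hy).2
  have hFm : ∀ n, MeasurableSet (F n) := fun n => by
    rw [hcover]
    exact Finset.measurableSet_biUnion _ fun y _ => measurableSet_cone _ _
  have hFn : ∀ n, M.runMeasure (F n ∩ E) ≤ M.runMeasure (F n) * c := by
    intro n
    have hsum : M.runMeasure (F n) =
        ∑ y ∈ Y n, M.runMeasure {ρ : ℕ → S | ∀ i ≤ n, ρ i = e n y i} := by
      rw [hcover, measure_biUnion_finset _ fun y _ => measurableSet_cone _ _]
      intro y _ z _ hyz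
      refine Set.disjoint_left.2 fun ρ h1 h2 => hyz (funext fun j => ?_)
      have := (h1 j (Nat.le_of_lt_succ j.2)).symm.trans (h2 j (Nat.le_of_lt_succ j.2))
      simpa [e] using this
    rw [hsum, Finset.sum_mul]
    have hsub : F n ∩ E ⊆ ⋃ y ∈ Y n, ({ρ : ℕ → S | ∀ i ≤ n, ρ i = e n y i} ∩ E) := by
      rw [hcover, Set.iUnion₂_inter]
    refine (measure_mono hsub).trans ((measure_biUnion_finset_le _ _).trans ?_)
    refine Finset.sum_le_sum fun y hy => ?_
    have := (Finset.mem_filter.1 hy).2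
    exact hE n _ this.1 this.2
  have hEF : E ⊆ ⋃ n, (F n ∩ E) := fun ρ hρ =>
    Set.mem_iUnion.2 ⟨Nat.find (hfinite ρ hρ),
      ⟨Nat.find_spec (hfinite ρ hρ), fun m hm => Nat.find_min (hfinite ρ hρ) hm⟩, hρ⟩
  have hdisj : Pairwise (Function.onFun Disjoint F) := by
    intro n m hnm
    refine Set.disjoint_left.2 fun ρ h1 h2 => ?_
    rcases lt_or_gt_of_ne hnm with h | h
    · exact h2.2 n h h1.1
    · exact h1.2 m h h2.1
  calc M.runMeasure E ≤ ∑' n, M.runMeasure (F n ∩ E) :=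
        (measure_mono hEF).trans (measure_iUnion_le _)
    _ ≤ ∑' n, M.runMeasure (F n) * c := ENNReal.tsum_le_tsum hFn
    _ = M.runMeasure (⋃ n, F n) * c := by rw [ENNReal.tsum_mul_right, measure_iUnion hdisj hFm]
    _ ≤ c := mul_le_of_le_one_left' prob_le_one

lemma ae_transition_pos (M : MarkovChain S) :
    ∀ᵐ ρ ∂M.runMeasure, ∀ n, 0 < M.P (ρ n) (ρ (n + 1)) := by
  rw [ae_all_iff]
  intro n
  have hsub : {ρ : ℕ → S | ¬ 0 < M.P (ρ n) (ρ (n + 1))} ⊆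
      ⋃ p ∈ {p : S × S | M.P p.1 p.2 = 0}, {ρ | ρ n = p.1 ∧ ρ (n + 1) = p.2} := by
    intro ρ hρ
    simp only [Set.mem_iUnion]
    exact ⟨(ρ n, ρ (n + 1)), le_antisymm (not_lt.1 hρ) (M.P_nonneg _ _), rfl, rfl⟩
  refine measure_mono_null hsub ((measure_biUnion_null_iff (Set.to_countable _)).2 ?_)
  rintro ⟨s, t⟩ hst
  have h := M.runMeasure_step n s t {y | y ⟨n, by simp⟩ = s} (fun y hy => hy)
  rw [show M.P s t = 0 from hst, ENNReal.ofReal_zero, mul_zero] at h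
  exact h

/-- After the path `a 0 ⋯ a n`, the probability of leaving `s` at least `k` times without moving
to `t` is at most `(1 - q) ^ k`, for `q ≤ P s t`. -/
lemma avoid_le [DecidableEq S] (M : MarkovChain S) {s t : S} {q : ℝ} (hq : q ≤ M.P s t)
    (h0 : 0 ≤ q) (h1 : q < 1) (n : ℕ) (a : ℕ → S) (k : ℝ) :
    M.runMeasure {ρ | (∀ i ≤ n, ρ i = a i) ∧ ∃ m : ℕ,
        k ≤ Nat.count (fun j => ρ (n + j) = s) m ∧
        ∀ j < m, ρ (n + j) = s → ρ (n + j + 1) ≠ t} ≤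
      M.runMeasure {ρ | ∀ i ≤ n, ρ i = a i} * ENNReal.ofReal ((1 - q) ^ k) := by
  have hq1 : 0 < 1 - q := by linarith
  have hb : 1 ≤ (1 - q)⁻¹ := (one_le_inv₀ hq1).2 (by linarith)
  have h := M.maximal_inequality
    (f := fun u v => if u = s then (if v = t then 0 else (1 - q)⁻¹) else 1)
    (fun u v => by split_ifs <;> positivity) (fun u => ?_) n a
    (x := (1 - q) ^ (-k)) (Real.rpow_pos_of_pos hq1 _)
  · rw [← Real.rpow_neg hq1.le, neg_neg] at h
    refine (measure_mono ?_).trans h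
    rintro ρ ⟨hρ, m, hm, hav⟩
    refine ⟨hρ, m, ?_⟩
    have hprod : ∏ j ∈ Finset.range m, (if ρ (n + j) = s then
        (if ρ (n + j + 1) = t then 0 else (1 - q)⁻¹) else 1) =
        ∏ j ∈ Finset.range m, (if ρ (n + j) = s then (1 - q)⁻¹ else 1) := by
      refine Finset.prod_congr rfl fun j hj => ?_
      by_cases hs : ρ (n + j) = s
      · rw [if_pos hs, if_pos hs, if_neg (hav j (Finset.mem_range.1 hj) hs)]
      · rw [if_neg hs, if_neg hs]
    rw [hprod, prod_ite_eq_pow_count, Real.rpow_neg hq1.le, ← Real.inv_rpow hq1.le,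
      ← Real.rpow_natCast]
    exact Real.rpow_le_rpow_of_exponent_le hb hm
  · by_cases hu : u = s
    · subst hu
      simp only [if_true]
      rw [M.sum_avoid, ← div_eq_mul_inv, div_le_one hq1]
      linarith
    · simp [hu, M.P_sum]

/-- A successor of a state visited infinitely often is visited infinitely often. -/
lemma ae_frequently_succ (M : MarkovChain S) :
    ∀ᵐ ρ ∂M.runMeasure, ∀ s t, 0 < M.P s t → (∃ᶠ n in atTop, ρ n = s) →
      ∃ᶠ n in atTop, ρ n = t := by
  classical
  have key : ∀ s t, 0 < M.P s t → ∀ n, M.runMeasure {ρ | (∃ᶠ n in atTop, ρ n = s) ∧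
      ∀ j, ρ (n + j) = s → ρ (n + j + 1) ≠ t} = 0 := by
    intro s t hst n
    -- `q < P s t` is strict to have `q < 1` also when `P s t = 1`
    obtain ⟨q, hq0, hq⟩ := exists_between hst
    have hq1 : q < 1 := hq.trans_le (M.P_le_one s t)
    have hle : ∀ k : ℕ, M.runMeasure {ρ | (∃ᶠ n in atTop, ρ n = s) ∧
        ∀ j, ρ (n + j) = s → ρ (n + j + 1) ≠ t} ≤ ENNReal.ofReal ((1 - q) ^ k) := by
      intro k
      refine M.runMeasure_le_of_first_time (B := fun m _ => m = n) (fun _ _ _ _ h => h)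
        (fun _ _ => ⟨n, rfl⟩) ?_
      rintro m a hm -
      rw [hm]
      have h := M.avoid_le hq.le hq0.le hq1 n a k
      rw [Real.rpow_natCast] at h
      refine (measure_mono ?_).trans h
      rintro ρ ⟨hρ, hf, hav⟩
      have hinf : {j | ρ (n + j) = s}.Infinite := by
        rw [← Nat.frequently_atTop_iff_infinite, frequently_atTop]
        intro m
        obtain ⟨j, hj, hj'⟩ := frequently_atTop.1 hf (n + m)
        exact ⟨j - n, by omega, by rwa [Nat.add_sub_cancel' (by omega)]⟩
      exact ⟨hρ, Nat.nth (fun j => ρ (n + j) = s) k,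
        by rw [Nat.count_nth_of_infinite hinf], fun j _ => hav j⟩
    have hlim : Tendsto (fun k : ℕ => ENNReal.ofReal ((1 - q) ^ k)) atTop (𝓝 0) := by
      rw [← ENNReal.ofReal_zero]
      exact ENNReal.tendsto_ofReal (tendsto_pow_atTop_nhds_zero_of_lt_one (by linarith)
        (by linarith))
    exact le_antisymm (ge_of_tendsto' hlim hle) zero_le
  rw [ae_all_iff]; intro s
  rw [ae_all_iff]; intro t
  by_cases hst : 0 < M.P s t
  · have : ∀ᵐ ρ ∂M.runMeasure, ∀ n, ¬ ((∃ᶠ n in atTop, ρ n = s) ∧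
        ∀ j, ρ (n + j) = s → ρ (n + j + 1) ≠ t) := by
      rw [ae_all_iff]; intro n
      exact measure_mono_null (fun ρ h => not_not.1 h) (key s t hst n)
    filter_upwards [this] with ρ hρ _ hf
    rw [frequently_atTop]
    intro n
    by_contra hcon
    push Not at hcon
    exact hρ n ⟨hf, fun j _ => hcon _ (by omega)⟩
  · exact Eventually.of_forall fun ρ h => absurd h hst

/-- Hoeffding's lemma for the indicator of the successor `t` of `s`. -/
lemma sum_exp_le [DecidableEq S] (M : MarkovChain S) (s t : S) (l : ℝ) :
    ∑ v, M.P s v * Real.exp (l * ((if v = t then 1 else 0) - M.P s t) - l ^ 2 / 8) ≤ 1 := by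
  have := isProbabilityMeasure_weightMeasure (M.P_nonneg s) (M.P_sum s)
  have hw : ∀ v, (weightMeasure (M.P s)).real {v} = M.P s v := fun v => by
    rw [Measure.real, weightMeasure_singleton, ENNReal.toReal_ofReal (M.P_nonneg s v)]
  have hint : ∫ v, (if v = t then (1 : ℝ) else 0) ∂(weightMeasure (M.P s)) = M.P s t := by
    rw [integral_fintype Integrable.of_finite]
    simp [hw]
  have h := (hasSubgaussianMGF_of_mem_Icc (μ := weightMeasure (M.P s)) (a := 0) (b := 1)
    (X := fun v : S => if v = t then (1 : ℝ) else 0) (measurable_of_finite _).aemeasurable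
    (Eventually.of_forall fun v => by split_ifs <;> simp)).mgf_le l
  rw [hint, mgf, integral_fintype Integrable.of_finite] at h
  simp only [hw, smul_eq_mul, sub_zero, nnnorm_one] at h
  have h2 : Real.exp (((1 / 2 : NNReal) ^ 2 : NNReal) * l ^ 2 / 2) = Real.exp (l ^ 2 / 8) := by
    congr 1; push_cast; ring
  rw [h2] at h
  simp_rw [Real.exp_sub, ← mul_div_assoc, ← Finset.sum_div]
  exact (div_le_one (Real.exp_pos _)).2 h

/-- One side of Hoeffding's inequality, for all numbers of samples from `k` on at once. The
sign `σ` tells the side. -/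
lemma deviation_one_sided_le [DecidableEq S] (M : MarkovChain S) (s t : S) {ξ σ : ℝ} (hξ : 0 < ξ)
    (hσ : σ ^ 2 = 1) (n : ℕ) (a : ℕ → S) (k : ℝ) :
    M.runMeasure {ρ | (∀ i ≤ n, ρ i = a i) ∧ ∃ m : ℕ,
        k ≤ Nat.count (fun j => ρ (n + j) = s) m ∧
        ξ * Nat.count (fun j => ρ (n + j) = s) m ≤
          σ * (Nat.count (fun j => ρ (n + j) = s ∧ ρ (n + j + 1) = t) m -
            M.P s t * Nat.count (fun j => ρ (n + j) = s) m)} ≤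
      M.runMeasure {ρ | ∀ i ≤ n, ρ i = a i} * ENNReal.ofReal (Real.exp (-(2 * ξ ^ 2 * k))) := by
  -- the exponential supermartingale with the optimal parameter `4 ξ`
  have h := M.maximal_inequality
    (f := fun u v => if u = s then Real.exp (4 * ξ * σ * ((if v = t then 1 else 0) - M.P s t) -
      (4 * ξ * σ) ^ 2 / 8) else 1)
    (fun u v => by split_ifs <;> positivity) (fun u => ?_) n a
    (x := Real.exp (2 * ξ ^ 2 * k)) (Real.exp_pos _)
  · rw [← Real.exp_neg] at h
    refine (measure_mono ?_).trans h
    rintro ρ ⟨hρ, m, hm, hdev⟩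
    refine ⟨hρ, m, ?_⟩
    have hprod : ∏ j ∈ Finset.range m, (if ρ (n + j) = s then
        Real.exp (4 * ξ * σ * ((if ρ (n + j + 1) = t then 1 else 0) - M.P s t) -
          (4 * ξ * σ) ^ 2 / 8) else 1) =
        Real.exp (4 * ξ * (σ * (Nat.count (fun j => ρ (n + j) = s ∧ ρ (n + j + 1) = t) m -
            M.P s t * Nat.count (fun j => ρ (n + j) = s) m)) -
          2 * ξ ^ 2 * Nat.count (fun j => ρ (n + j) = s) m) := by
      clear hm hdev
      induction m with
      | zero => simp
      | succ m ih =>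
        rw [Finset.prod_range_succ, ih, Nat.count_succ, Nat.count_succ]
        by_cases h1 : ρ (n + m) = s
        · rw [if_pos h1, ← Real.exp_add]
          congr 1
          by_cases h2 : ρ (n + m + 1) = t
          · simp only [h1, h2, true_and, if_true]
            push_cast
            linear_combination (-2 * ξ ^ 2) * hσ
          · simp only [h1, h2, true_and, if_true, if_false]
            push_cast
            linear_combination (-2 * ξ ^ 2) * hσ
        · simp [h1]
    rw [hprod]
    refine Real.exp_le_exp.2 ?_
    have h1 := mul_le_mul_of_nonneg_left hdev (by positivity : 0 ≤ 4 * ξ)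
    have h2 := mul_le_mul_of_nonneg_left hm (by positivity : 0 ≤ 2 * ξ ^ 2)
    nlinarith
  · by_cases hu : u = s
    · subst hu
      simpa only [if_true] using M.sum_exp_le u t (4 * ξ * σ)
    · simp [hu, M.P_sum]

/-- Hoeffding's inequality, for all numbers of samples from `k` on at once. -/
lemma deviation_le [DecidableEq S] (M : MarkovChain S) (s t : S) {ξ : ℝ} (hξ : 0 < ξ)
    (n : ℕ) (a : ℕ → S) (k : ℝ) :
    M.runMeasure {ρ | (∀ i ≤ n, ρ i = a i) ∧ ∃ m : ℕ,
        k ≤ Nat.count (fun j => ρ (n + j) = s) m ∧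
        ξ * Nat.count (fun j => ρ (n + j) = s) m ≤
          |Nat.count (fun j => ρ (n + j) = s ∧ ρ (n + j + 1) = t) m -
            M.P s t * Nat.count (fun j => ρ (n + j) = s) m|} ≤
      M.runMeasure {ρ | ∀ i ≤ n, ρ i = a i} *
        ENNReal.ofReal (2 * Real.exp (-(2 * ξ ^ 2 * k))) := by
  have h1 := M.deviation_one_sided_le s t (σ := 1) hξ (by norm_num) n a k
  have h2 := M.deviation_one_sided_le s t (σ := -1) hξ (by norm_num) n a k
  rw [two_mul, ENNReal.ofReal_add (Real.exp_pos _).le (Real.exp_pos _).le, mul_add]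
  refine (measure_mono ?_).trans ((measure_union_le _ _).trans (add_le_add h1 h2))
  rintro ρ ⟨hρ, m, hm, hdev⟩
  rcases le_abs.1 hdev with h | h
  · exact Or.inl ⟨hρ, m, hm, by linarith⟩
  · exact Or.inr ⟨hρ, m, hm, by linarith⟩

end MarkovChain

/-! ### Paths that are prefixes of a run -/

/-- A strongly connected set that no edge leaves is automatically maximal. -/
lemma isBSCC_iff {S : Type*} {E : S → S → Prop} {C : Finset S} :
    IsBSCC E C ↔ IsSC E C ∧ ∀ s ∈ C, ∀ t, t ∉ C → ¬ E s t := by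
  refine ⟨fun h => ⟨h.1.prop, h.2⟩, fun ⟨h1, h2⟩ => ⟨⟨h1, fun D hD hCD t ht => ?_⟩, h2⟩⟩
  obtain ⟨s, hs⟩ := h1.1
  have key : ∀ t, Relation.TransGen E s t → t ∈ C := by
    intro t h
    induction h with
    | single h => by_contra hc; exact h2 s hs _ hc h
    | tail _ hbc ih => by_contra hc; exact h2 _ ih _ hc hbc
  exact key t (hD.2 s (hCD hs) t ht)

lemma count_map_range {S : Type*} [BEq S] [LawfulBEq S] [DecidableEq S] (f : ℕ → S) (x : S)
    (n : ℕ) :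
    ((List.range n).map f).count x = Nat.count (fun j => f j = x) n := by
  induction n with
  | zero => simp
  | succ n ih =>
    rw [List.range_succ, List.map_append, List.count_append, ih, Nat.count_succ]
    simp [List.count_singleton]

section runPrefix

variable {S : Type*} (ρ : ℕ → S)

lemma length_runPrefix (n : ℕ) : (runPrefix ρ n).length = n + 1 := by simp [runPrefix]

lemma runPrefix_ne_nil (n : ℕ) : runPrefix ρ n ≠ [] := by
  simp [runPrefix]

lemma runPrefix_succ (n : ℕ) : runPrefix ρ (n + 1) = runPrefix ρ n ++ [ρ (n + 1)] := by
  simp [runPrefix, List.range_succ]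

lemma getLast_runPrefix (n : ℕ) : (runPrefix ρ n).getLast (runPrefix_ne_nil ρ n) = ρ n := by
  simp [runPrefix, List.getLast_eq_getElem]

lemma mem_runPrefix {n : ℕ} {s : S} : s ∈ runPrefix ρ n ↔ ∃ j ≤ n, ρ j = s := by
  simp [runPrefix]

lemma runPrefix_add (a m : ℕ) :
    runPrefix ρ (a + m) = (List.range a).map ρ ++ runPrefix (fun j => ρ (a + j)) m := by
  rw [runPrefix, runPrefix, Nat.add_assoc, List.range_add, List.map_append, List.map_map]
  rfl

lemma zip_tail_runPrefix (n : ℕ) :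
    (runPrefix ρ n).zip (runPrefix ρ n).tail = (List.range n).map fun j => (ρ j, ρ (j + 1)) := by
  refine List.ext_getElem (by simp [runPrefix]) fun i h1 h2 => by simp [runPrefix]

lemma dropLast_runPrefix (n : ℕ) : (runPrefix ρ n).dropLast = (List.range n).map ρ := by
  simp [runPrefix, List.range_succ]

lemma pathEdge_runPrefix {n : ℕ} {s t : S} :
    pathEdge (runPrefix ρ n) s t ↔ ∃ j < n, ρ j = s ∧ ρ (j + 1) = t := by
  simp [pathEdge, zip_tail_runPrefix]

lemma pathEdge_runPrefix_mono {n n' : ℕ} (h : n ≤ n') {s t : S}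
    (hst : pathEdge (runPrefix ρ n) s t) : pathEdge (runPrefix ρ n') s t := by
  rw [pathEdge_runPrefix] at *
  obtain ⟨j, hj, hj'⟩ := hst
  exact ⟨j, by omega, hj'⟩

lemma suffix_runPrefix {n : ℕ} {κ : List S} (h : κ <:+ runPrefix ρ n) (hκ : κ ≠ []) :
    ∃ a m, a + m = n ∧ κ = runPrefix (fun j => ρ (a + j)) m := by
  obtain ⟨η, h⟩ := h
  have hlen := congrArg List.length h
  have hpos := List.length_pos_iff.2 hκ
  rw [List.length_append, length_runPrefix] at hlen
  refine ⟨η.length, n - η.length, by omega, ?_⟩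
  rw [show n = η.length + (n - η.length) by omega, runPrefix_add] at h
  have := (List.append_inj h (by simp)).2
  simpa using this

variable {ρ}

lemma transGen_pathEdge {n i j : ℕ} (hij : i < j) (hj : j ≤ n) :
    Relation.TransGen (pathEdge (runPrefix ρ n)) (ρ i) (ρ j) := by
  induction j, hij using Nat.le_induction with
  | base => exact .single ((pathEdge_runPrefix ρ).2 ⟨i, by omega, rfl, rfl⟩)
  | succ j hij ih =>
    exact (ih (by omega)).tail ((pathEdge_runPrefix ρ).2 ⟨j, by omega, rfl, rfl⟩)

lemma frequently_shift {s : S} (hf : ∃ᶠ n in atTop, ρ n = s) (a : ℕ) :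
    ∃ᶠ n in atTop, ρ (a + n) = s := by
  rw [frequently_atTop] at *
  intro m
  obtain ⟨j, hj, hj'⟩ := hf (a + m)
  exact ⟨j - a, by omega, by rwa [Nat.add_sub_cancel' (by omega)]⟩

lemma eventually_visited {D : Finset S} (hf : ∀ s ∈ D, ∃ᶠ n in atTop, ρ n = s) :
    ∀ᶠ n in atTop, ∀ s ∈ D, ∃ j ≤ n, ρ j = s := by
  rw [Filter.eventually_all_finset]
  intro s hs
  obtain ⟨i, -, hi⟩ := frequently_atTop.1 (hf s hs) 0
  filter_upwards [eventually_ge_atTop i] with n hn using ⟨i, hn, hi⟩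

lemma eventually_isBSCC {T : ℕ} {D : Finset S} (hD : ∀ j, ρ j ∈ D ↔ T ≤ j)
    (hf : ∀ s ∈ D, ∃ᶠ n in atTop, ρ n = s) :
    ∀ᶠ n in atTop, IsBSCC (pathEdge (runPrefix ρ n)) D := by
  have h1 : ∀ᶠ n in atTop, ∀ s ∈ D, ∀ t ∈ D,
      Relation.TransGen (pathEdge (runPrefix ρ n)) s t := by
    rw [Filter.eventually_all_finset]
    intro s hs
    rw [Filter.eventually_all_finset]
    intro t ht
    obtain ⟨i, -, hi⟩ := frequently_atTop.1 (hf s hs) 0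
    obtain ⟨j, hj, hj'⟩ := frequently_atTop.1 (hf t ht) (i + 1)
    filter_upwards [eventually_ge_atTop j] with n hn
    rw [← hi, ← hj']
    exact transGen_pathEdge hj hn
  filter_upwards [h1] with n hn
  rw [isBSCC_iff]
  refine ⟨⟨⟨ρ T, (hD T).2 le_rfl⟩, hn⟩, fun s hs t ht hst => ?_⟩
  obtain ⟨j, -, rfl, rfl⟩ := (pathEdge_runPrefix ρ).1 hst
  have := (hD j).1 hs
  exact ht ((hD _).2 (by omega))

variable (ρ)
variable [DecidableEq S]

lemma count_runPrefix (s : S) (n : ℕ) :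
    (runPrefix ρ n).count s = Nat.count (fun j => ρ j = s) (n + 1) :=
  count_map_range ρ s (n + 1)

lemma stateCount_runPrefix (s : S) (n : ℕ) :
    stateCount (runPrefix ρ n) s = Nat.count (fun j => ρ j = s) n := by
  rw [stateCount, dropLast_runPrefix, count_map_range]

lemma transCount_runPrefix (s t : S) (n : ℕ) :
    transCount (runPrefix ρ n) s t = Nat.count (fun j => ρ j = s ∧ ρ (j + 1) = t) n := by
  rw [transCount, zip_tail_runPrefix, count_map_range]
  simp only [Prod.mk.injEq]

/-! ### Candidates of the prefixes of a run -/

lemma isCandidate_runPrefix_iff {n : ℕ} {C : Finset S} :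
    IsCandidate (runPrefix ρ n) C ↔ IsBSCC (pathEdge (runPrefix ρ n)) C ∧
      ∃ a ≤ n, ∀ s, s ∈ C ↔ ∃ j, a ≤ j ∧ j ≤ n ∧ ρ j = s := by
  have key : ∀ a m : ℕ, ∀ s, s ∈ (runPrefix (fun j => ρ (a + j)) m).toFinset ↔
      ∃ j, a ≤ j ∧ j ≤ a + m ∧ ρ j = s := by
    intro a m s
    rw [List.mem_toFinset, mem_runPrefix]
    exact ⟨fun ⟨j, hj, h⟩ => ⟨a + j, by omega, by omega, h⟩,
      fun ⟨j, h1, h2, h⟩ => ⟨j - a, by omega, by rwa [Nat.add_sub_cancel' h1]⟩⟩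
  constructor
  · rintro ⟨κ, hκ, hC, hB⟩
    refine ⟨hB, ?_⟩
    obtain ⟨a, m, rfl, rfl⟩ := suffix_runPrefix ρ hκ (by
      rintro rfl
      obtain ⟨x, hx⟩ := hB.1.prop.1
      simp [← hC] at hx)
    exact ⟨a, by omega, fun s => by rw [← hC, key]⟩
  · rintro ⟨hB, a, ha, hC⟩
    obtain ⟨m, rfl⟩ := Nat.exists_eq_add_of_le ha
    refine ⟨runPrefix (fun j => ρ (a + j)) m, ?_, Finset.ext fun s => by rw [hC, key], hB⟩
    rw [runPrefix_add]
    exact List.suffix_append _ _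

lemma candidate_nil_ne (C : Finset S) : candidate ([] : List S) ≠ some C := by
  rw [Ne, candidate_eq_some_iff]
  rintro ⟨κ, hκ, hC, hB⟩
  obtain ⟨x, hx⟩ := hB.1.prop.1
  simp [← hC, List.suffix_nil.1 hκ] at hx

lemma candidate_nil : candidate ([] : List S) = none := by
  cases h : candidate ([] : List S) with
  | none => rfl
  | some C => exact absurd h (candidate_nil_ne C)

variable {ρ}

lemma mem_of_candidate {n : ℕ} {C : Finset S} (h : candidate (runPrefix ρ n) = some C) :
    ρ n ∈ C := by
  rw [candidate_eq_some_iff, isCandidate_runPrefix_iff] at h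
  obtain ⟨-, a, ha, hC⟩ := h
  exact (hC _).2 ⟨n, ha, le_rfl, rfl⟩

lemma visited_of_candidate {n : ℕ} {C : Finset S} (h : candidate (runPrefix ρ n) = some C)
    {s : S} (hs : s ∈ C) : ∃ j ≤ n, ρ j = s := by
  rw [candidate_eq_some_iff, isCandidate_runPrefix_iff] at h
  obtain ⟨-, a, -, hC⟩ := h
  obtain ⟨j, -, h⟩ := (hC s).1 hs
  exact ⟨j, h⟩

/-- A candidate persists as long as the run does not leave it. -/
lemma candidate_persists {n n' : ℕ} {C : Finset S} (h : candidate (runPrefix ρ n) = some C)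
    (hn : n ≤ n') (hC : ∀ j, n ≤ j → j ≤ n' → ρ j ∈ C) : candidate (runPrefix ρ n') = some C := by
  rw [candidate_eq_some_iff, isCandidate_runPrefix_iff, isBSCC_iff] at *
  obtain ⟨⟨⟨hne, hsc⟩, hout⟩, a, ha, hCa⟩ := h
  refine ⟨⟨⟨hne, fun s hs t ht => Relation.TransGen.mono
    (fun _ _ => pathEdge_runPrefix_mono ρ hn) _ _ (hsc s hs t ht)⟩, fun s hs t ht hst => ?_⟩,
    a, by omega, fun s => ⟨fun hs => ?_, ?_⟩⟩
  · obtain ⟨j, hj, rfl, rfl⟩ := (pathEdge_runPrefix ρ).1 hst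
    rcases Nat.lt_or_ge j n with h | h
    · exact hout _ hs _ ht ((pathEdge_runPrefix ρ).2 ⟨j, h, rfl, rfl⟩)
    · exact ht (hC _ (by omega) (by omega))
  · obtain ⟨j, h1, h2, h3⟩ := (hCa s).1 hs
    exact ⟨j, h1, by omega, h3⟩
  · rintro ⟨j, h1, h2, rfl⟩
    rcases Nat.lt_or_ge j n with h | h
    · exact (hCa _).2 ⟨j, h1, h.le, rfl⟩
    · exact hC j h h2

/-- The registers of `ReachedBSCC` after the loop. -/
noncomputable def candidateRegisters (π : List S) : Option (Finset S) × ℕ :=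
  π.inits.foldl candidateStep (none, 0)

lemma candidateRegisters_append_singleton (π : List S) (x : S) :
    candidateRegisters (π ++ [x]) = candidateStep (candidateRegisters π) (π ++ [x]) := by
  simp [candidateRegisters, List.inits_append]

lemma candidateRegisters_nil : candidateRegisters ([] : List S) = (none, 0) := by
  simp [candidateRegisters, candidateStep, candidate_nil]

lemma candidateRegisters_succ (n : ℕ) : candidateRegisters (runPrefix ρ (n + 1)) =
    candidateStep (candidateRegisters (runPrefix ρ n)) (runPrefix ρ (n + 1)) := by
  rw [runPrefix_succ, candidateRegisters_append_singleton]

lemma candidateRegisters_zero : candidateRegisters (runPrefix ρ 0) =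
    candidateStep (none, 0) (runPrefix ρ 0) := by
  have := candidateRegisters_append_singleton ([] : List S) (ρ 0)
  rwa [candidateRegisters_nil] at this

lemma candidateStep_fst {c : Option (Finset S) × ℕ} {η : List S} {C : Finset S}
    (h : candidate η = some C) : (candidateStep c η).1 = some C := by
  unfold candidateStep
  split_ifs with h1
  · exact h
  · rw [h] at h1
    push Not at h1
    exact (h1 (by simp)).symm

lemma candidateRegisters_fst {n : ℕ} {C : Finset S} (h : candidate (runPrefix ρ n) = some C) :
    (candidateRegisters (runPrefix ρ n)).1 = some C := by
  cases n with
  | zero => rw [candidateRegisters_zero]; exact candidateStep_fst h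
  | succ n => rw [candidateRegisters_succ]; exact candidateStep_fst h

lemma exists_candidate_of_registers {n : ℕ} {C : Finset S}
    (h : (candidateRegisters (runPrefix ρ n)).1 = some C) :
    ∃ m ≤ n, candidate (runPrefix ρ m) = some C := by
  induction n with
  | zero =>
    rw [candidateRegisters_zero, candidateStep] at h
    split_ifs at h with h1
    exact ⟨0, le_rfl, h⟩
  | succ n ih =>
    rw [candidateRegisters_succ, candidateStep] at h
    split_ifs at h with h1
    · exact ⟨n + 1, le_rfl, h⟩
    · obtain ⟨m, hm, h⟩ := ih h
      exact ⟨m, by omega, h⟩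

lemma candidateIndex_mono : Monotone fun n => candidateIndex (runPrefix ρ n) := by
  refine monotone_nat_of_le_succ fun n => ?_
  change (candidateRegisters (runPrefix ρ n)).2 ≤ (candidateRegisters (runPrefix ρ (n + 1))).2
  rw [candidateRegisters_succ, candidateStep]
  split_ifs <;> simp

lemma one_le_candidateIndex {n : ℕ} {C : Finset S} (h : candidate (runPrefix ρ n) = some C) :
    1 ≤ candidateIndex (runPrefix ρ n) := by
  have key : ∀ n, (candidateRegisters (runPrefix ρ n)).1 ≠ none →
      1 ≤ (candidateRegisters (runPrefix ρ n)).2 := by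
    intro n
    induction n with
    | zero =>
      rw [candidateRegisters_zero, candidateStep]
      split_ifs <;> simp
    | succ n ih =>
      rw [candidateRegisters_succ, candidateStep]
      split_ifs
      · simp
      · exact ih
  exact key n (by rw [candidateRegisters_fst h]; simp)

lemma candidateIndex_eq_of_candidate {n n' : ℕ} {C : Finset S} (hn : n ≤ n')
    (h : ∀ j, n ≤ j → j ≤ n' → candidate (runPrefix ρ j) = some C) :
    candidateIndex (runPrefix ρ n') = candidateIndex (runPrefix ρ n) := by
  induction n', hn using Nat.le_induction with
  | base => rfl
  | succ m hm ih =>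
    rw [← ih fun j h1 h2 => h j h1 (by omega)]
    change (candidateRegisters (runPrefix ρ (m + 1))).2 = (candidateRegisters (runPrefix ρ m)).2
    rw [candidateRegisters_succ, candidateStep, if_neg]
    rw [h (m + 1) (by omega) le_rfl, candidateRegisters_fst (h m hm (by omega))]
    simp

/-- A strong candidate was born at the first time `n₀` at which the candidate index has its present
value, and since then the run has left every state of the candidate at least `k` times, without
leaving the candidate. -/
lemma IsStrongKCandidate.birth {k : ℝ} {C : Finset S} {n : ℕ}
    (h : IsStrongKCandidate k C (runPrefix ρ n)) :
    ∃ n₀ m, n₀ + m = n ∧ candidate (runPrefix ρ n₀) = some C ∧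
      (∀ j < n₀, candidateIndex (runPrefix ρ j) < candidateIndex (runPrefix ρ n₀)) ∧
      candidateIndex (runPrefix ρ n₀) = candidateIndex (runPrefix ρ n) ∧
      (∀ j ≤ m, ρ (n₀ + j) ∈ C) ∧
      ∀ s ∈ C, k ≤ Nat.count (fun j => ρ (n₀ + j) = s) m := by
  obtain ⟨α, β, b, γ, hπ, hα, hsupp, hbefore, hbirth, hk⟩ := h
  have hlen := congrArg List.length hπ
  simp only [length_runPrefix, List.length_append, List.length_cons] at hlen
  obtain ⟨A, hA⟩ : ∃ A, A = α.length := ⟨_, rfl⟩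
  obtain ⟨B, hB⟩ : ∃ B, B = β.length := ⟨_, rfl⟩
  obtain ⟨m, hm⟩ : ∃ m, m = γ.length := ⟨_, rfl⟩
  obtain rfl : n = A + B + m := by omega
  have e1 := hπ
  rw [runPrefix_add] at e1
  obtain ⟨e1, e2⟩ := List.append_inj e1 (by simp; omega)
  have e3 : runPrefix ρ (A + B) = α ++ β ++ [b] := by
    have : b = ρ (A + B) := by
      have := congrArg List.head? e2
      simpa [runPrefix, List.range_succ_eq_map] using this.symm
    rw [← e1, this, runPrefix, List.range_succ, List.map_append]
    rfl
  have e4 := hπ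
  rw [Nat.add_assoc, runPrefix_add, List.append_assoc] at e4
  obtain ⟨e4, e5⟩ := List.append_inj e4 (by simp; omega)
  have hin : ∀ j, A ≤ j → j ≤ A + B + m → ρ j ∈ C := by
    intro j h1 h2
    rw [← hsupp, ← e5, List.mem_toFinset, mem_runPrefix]
    exact ⟨j - A, by omega, by rw [Nat.add_sub_cancel' h1]⟩
  have hout : ∀ j < A, ρ j ∉ C := by
    intro j hj
    refine hα _ ?_
    rw [← e4]
    exact List.mem_map.2 ⟨j, List.mem_range.2 hj, rfl⟩
  have hcand : candidate (runPrefix ρ (A + B)) = some C := by rw [e3, hbirth]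
  refine ⟨A + B, m, rfl, hcand, fun j hj => ?_, ?_, fun j hj => hin _ (by omega) (by omega),
    fun s hs => ?_⟩
  · obtain ⟨n₁, hn₁⟩ : ∃ n₁, A + B = n₁ + 1 := ⟨A + B - 1, by omega⟩
    have e6 : runPrefix ρ n₁ = α ++ β := by rw [← e1, hn₁, runPrefix]
    refine (candidateIndex_mono (by omega : j ≤ n₁)).trans_lt ?_
    change (candidateRegisters (runPrefix ρ n₁)).2 < (candidateRegisters (runPrefix ρ (A + B))).2
    rw [hn₁, candidateRegisters_succ, candidateStep, if_pos]
    · simp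
    rw [← hn₁, hcand]
    refine ⟨by simp, fun hreg => hbefore ?_⟩
    obtain ⟨i, hi, hci⟩ := exists_candidate_of_registers hreg.symm
    have hAi : A ≤ i := by
      by_contra hlt
      exact hout i (by omega) (mem_of_candidate hci)
    rw [← e6]
    exact candidate_persists hci hi fun j h1 h2 => hin j (by omega) (by omega)
  · refine (candidateIndex_eq_of_candidate (C := C) (by omega) fun j h1 h2 => ?_).symm
    exact candidate_persists hcand h1 fun i h3 h4 => hin i (by omega) (by omega)
  · -- the last state of the path has not been left yet, hence the extra occurrence
    obtain ⟨κ, hκ, hκC, -, hcount, hne, hlast⟩ := hk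
    rw [← e2] at hκ
    have hle : κ.count s ≤ Nat.count (fun j => ρ (A + B + j) = s) (m + 1) := by
      rw [← count_runPrefix]; exact hκ.sublist.count_le s
    have hl : κ.getLast hne = ρ (A + B + m) := by
      rw [← getLast_runPrefix (fun j => ρ (A + B + j)) m]
      exact hκ.getLast hne
    rw [Nat.count_succ] at hle
    by_cases hs' : ρ (A + B + m) = s
    · rw [if_pos hs'] at hle
      rw [hl, hs'] at hlast
      have : (κ.count s : ℝ) ≤ Nat.count (fun j => ρ (A + B + j) = s) m + 1 := by
        exact_mod_cast hle
      linarith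
    · rw [if_neg hs'] at hle
      have : (κ.count s : ℝ) ≤ Nat.count (fun j => ρ (A + B + j) = s) m := by
        exact_mod_cast hle
      linarith [hcount s hs]

/-! ### Runs that stay in a set and visit all its states infinitely often -/

lemma eventually_count_ge {s : S} (hf : ∃ᶠ n in atTop, ρ n = s) (k : ℝ) :
    ∀ᶠ n in atTop, k ≤ Nat.count (fun j => ρ j = s) n := by
  obtain ⟨K, hK⟩ := exists_nat_ge k
  have hinf : {j | ρ j = s}.Infinite := Nat.frequently_atTop_iff_infinite.1 hf
  filter_upwards [eventually_ge_atTop (Nat.nth (fun j => ρ j = s) K)] with n hn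
  refine hK.trans (Nat.cast_le.2 ?_)
  calc K = Nat.count (fun j => ρ j = s) (Nat.nth (fun j => ρ j = s) K) :=
        (Nat.count_nth_of_infinite hinf K).symm
    _ ≤ _ := Nat.count_monotone _ hn

lemma eventually_isCandidate {T : ℕ} {D : Finset S} (hD : ∀ j, ρ j ∈ D ↔ T ≤ j)
    (hf : ∀ s ∈ D, ∃ᶠ n in atTop, ρ n = s) :
    ∀ᶠ n in atTop, candidate (runPrefix ρ n) = some D := by
  filter_upwards [eventually_isBSCC hD hf, eventually_visited hf, eventually_ge_atTop T] with
    n hB h1 hT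
  rw [candidate_eq_some_iff, isCandidate_runPrefix_iff]
  refine ⟨hB, T, hT, fun s => ⟨fun hs => ?_, ?_⟩⟩
  · obtain ⟨j, hj, rfl⟩ := h1 s hs
    exact ⟨j, (hD j).1 hs, hj, rfl⟩
  · rintro ⟨j, hj, -, rfl⟩
    exact (hD j).2 hj

lemma eventually_isKCandidate {D : Finset S} (hD : ∀ j, ρ j ∈ D)
    (hf : ∀ s ∈ D, ∃ᶠ n in atTop, ρ n = s) (k : ℝ) :
    ∀ᶠ n in atTop, IsKCandidate k (runPrefix ρ n) D := by
  have hc : ∀ᶠ n in atTop, ∀ s ∈ D, k + 1 ≤ Nat.count (fun j => ρ j = s) n := by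
    rw [Filter.eventually_all_finset]
    exact fun s hs => eventually_count_ge (hf s hs) (k + 1)
  have hB := eventually_isBSCC (T := 0) (fun j => by simp [hD]) hf
  filter_upwards [hc, hB, eventually_visited hf] with n hc hB hv
  have hc' : ∀ s ∈ D, k + 1 ≤ ((runPrefix ρ n).count s : ℝ) := fun s hs => by
    rw [count_runPrefix]
    exact (hc s hs).trans (Nat.cast_le.2 (Nat.count_monotone _ (by omega)))
  refine ⟨runPrefix ρ n, List.suffix_rfl, ?_, hB, fun s hs => by linarith [hc' s hs],
    runPrefix_ne_nil ρ n, ?_⟩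
  · ext s
    rw [List.mem_toFinset]
    rw [mem_runPrefix]
    refine ⟨?_, hv s⟩
    rintro ⟨j, -, rfl⟩
    exact hD j
  · rw [getLast_runPrefix]
    exact hc' _ (hD n)

lemma eventually_isStrongKCandidate {T : ℕ} {D : Finset S} (hD : ∀ j, ρ j ∈ D ↔ T ≤ j)
    (hf : ∀ s ∈ D, ∃ᶠ n in atTop, ρ n = s) (k : ℝ) :
    ∀ᶠ n in atTop, IsStrongKCandidate k D (runPrefix ρ n) := by
  classical
  have hex := (eventually_isCandidate hD hf).exists
  obtain ⟨n₀, hn₀, hmin⟩ : ∃ n₀, candidate (runPrefix ρ n₀) = some D ∧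
      ∀ m < n₀, candidate (runPrefix ρ m) ≠ some D :=
    ⟨Nat.find hex, Nat.find_spec hex, fun m hm => Nat.find_min hex hm⟩
  obtain ⟨B, rfl⟩ := Nat.exists_eq_add_of_le ((hD n₀).1 (mem_of_candidate hn₀))
  have hK := eventually_isKCandidate (ρ := fun j => ρ (T + B + j)) (D := D)
    (fun j => (hD _).2 (by omega)) (fun s hs => frequently_shift (hf s hs) _) k
  obtain ⟨N, hN⟩ := eventually_atTop.1 hK
  filter_upwards [eventually_ge_atTop (T + B + N)] with n hn
  obtain ⟨m, rfl⟩ := Nat.exists_eq_add_of_le (show T + B ≤ n by omega)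
  have hsplit : (List.range T).map ρ ++ (List.range B).map (fun j => ρ (T + j)) =
      (List.range (T + B)).map ρ := by
    rw [List.range_add, List.map_append, List.map_map]; rfl
  have hcons : runPrefix (fun j => ρ (T + B + j)) m =
      ρ (T + B) :: (List.range m).map (fun j => ρ (T + B + (j + 1))) := by
    simp [runPrefix, List.range_succ_eq_map]
  refine ⟨(List.range T).map ρ, (List.range B).map (fun j => ρ (T + j)), ρ (T + B),
    (List.range m).map (fun j => ρ (T + B + (j + 1))), ?_, ?_, ?_, ?_, ?_, ?_⟩
  · rw [← hcons, hsplit, runPrefix_add]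
  · simp only [List.mem_map, List.mem_range]
    rintro s ⟨j, hj, rfl⟩ h
    exact absurd ((hD j).1 h) (by omega)
  · rw [← hcons]
    ext s
    simp only [List.mem_toFinset, List.mem_append, mem_runPrefix, List.mem_map, List.mem_range]
    constructor
    · rintro (⟨j, -, rfl⟩ | ⟨j, -, rfl⟩) <;> exact (hD _).2 (by omega)
    · intro hs
      obtain ⟨j, hj, rfl⟩ := visited_of_candidate hn₀ hs
      have := (hD j).1 hs
      rcases Nat.lt_or_ge j (T + B) with h | h
      · exact Or.inl ⟨j - T, by omega, by rw [Nat.add_sub_cancel' this]⟩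
      · exact Or.inr ⟨j - (T + B), by omega, by rw [Nat.add_sub_cancel' h]⟩
  · rw [hsplit]
    rcases Nat.eq_zero_or_pos (T + B) with h | h
    · rw [h]; exact candidate_nil_ne D
    · have := hmin (T + B - 1) (by omega)
      rwa [runPrefix, Nat.sub_add_cancel h] at this
  · rw [hsplit, ← hn₀, runPrefix, List.range_succ, List.map_append]
    rfl
  · rw [← hcons]
    exact hN m (by omega)

/-- A run that ends up in `D` and visits all its states infinitely often fulfils the exit
condition eventually: its candidate is `D` from some time on, so the candidate index is bounded
and the required strengths are constant. -/
lemma exists_singlePathMPUntil {T : ℕ} {D : Finset S} (hD : ∀ j, ρ j ∈ D ↔ T ≤ j)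
    (hf : ∀ s ∈ D, ∃ᶠ n in atTop, ρ n = s) (p ε δ : ℝ) :
    ∃ n, SinglePathMPUntil p ε δ (runPrefix ρ n) := by
  obtain ⟨N, hN⟩ := eventually_atTop.1 (eventually_isCandidate hD hf)
  obtain ⟨n, hn, h1, h2⟩ := ((eventually_ge_atTop N).and
    ((eventually_isStrongKCandidate hD hf (bsccStrength p (δ / 2)
      (candidateIndex (runPrefix ρ N)))).and
    (eventually_isStrongKCandidate hD hf (mpStrength p ε δ D.card)))).exists
  rw [← candidateIndex_eq_of_candidate hn fun j hj _ => hN j hj] at h1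
  exact ⟨n, ⟨one_le_candidateIndex (hN n hn), D, hN n hn, h1⟩, D, hN n hn, h2⟩

end runPrefix

/-! ### BSCCs as irreducible chains -/

lemma runPrefix_congr {S : Type*} {ρ ρ' : ℕ → S} {n : ℕ} (h : ∀ i ≤ n, ρ' i = ρ i) :
    runPrefix ρ' n = runPrefix ρ n :=
  List.map_congr_left fun i hi => h i (Nat.le_of_lt_succ (List.mem_range.1 hi))

lemma IsSC.exists_edge {S : Type*} {E : S → S → Prop} {C : Finset S} (h : IsSC E C) {s : S}
    (hs : s ∈ C) : ∃ v, E s v := by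
  obtain ⟨v, hv, -⟩ := Relation.TransGen.head'_iff.1 (h.2 s hs s hs)
  exact ⟨v, hv⟩

lemma IsBSCC.isIrredOn {S : Type*} [Fintype S] {Q : Matrix S S ℝ} {C : Finset S}
    (hC : IsBSCC (fun s t => 0 < Q s t) C) (h0 : ∀ s t, 0 ≤ Q s t)
    (h1 : ∀ s ∈ C, ∑ t, Q s t = 1) : IsIrredOn Q C := by
  have hcl : ∀ s ∈ C, ∀ t, t ∉ C → Q s t = 0 := fun s hs t ht =>
    le_antisymm (not_lt.1 (hC.2 s hs t ht)) (h0 s t)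
  refine ⟨hcl, fun i j => h0 _ _, fun i => ?_, fun i j => ?_⟩
  · rw [← h1 i i.2]
    exact (Finset.sum_coe_sort C fun t => Q i t).trans
      (Finset.sum_subset (Finset.subset_univ C) fun t _ ht => hcl i i.2 t ht)
  · have key : ∀ t, Relation.TransGen (fun s t => 0 < Q s t) i t → ∃ ht : t ∈ C,
        Relation.ReflTransGen
          (fun a b => 0 < Q.submatrix (Subtype.val : C → S) Subtype.val a b) i ⟨t, ht⟩ := by
      intro t h
      induction h with
      | @single b h =>
        have hb : b ∈ C := by
          by_contra hb; exact hC.2 i i.2 b hb h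
        exact ⟨hb, .single h⟩
      | @tail b c _ hbc ih =>
        obtain ⟨hb, ih⟩ := ih
        have hc : c ∈ C := by
          by_contra hc; exact hC.2 b hb c hc hbc
        exact ⟨hc, ih.tail hbc⟩
    exact (key j (hC.1.prop.2 i i.2 j j.2)).2

/-! ### The estimated transition matrix -/

lemma count_pos {p : ℕ → Prop} [DecidablePred p] {n j : ℕ} (hj : j < n) (h : p j) :
    0 < Nat.count p n :=
  Nat.pos_of_ne_zero fun h0 => Nat.count_iff_forall_not.1 h0 j hj h

section estMatrix

variable {S : Type*} [DecidableEq S] {ρ : ℕ → S} {n : ℕ}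

lemma estMatrix_nonneg (π : List S) (s t : S) : 0 ≤ estMatrix π s t := by
  unfold estMatrix; positivity

lemma estMatrix_runPrefix_pos_iff {s t : S} :
    0 < estMatrix (runPrefix ρ n) s t ↔ pathEdge (runPrefix ρ n) s t := by
  rw [estMatrix, transCount_runPrefix, stateCount_runPrefix, pathEdge_runPrefix]
  constructor
  · intro h
    by_contra hcon
    have : Nat.count (fun j => ρ j = s ∧ ρ (j + 1) = t) n = 0 :=
      Nat.count_iff_forall_not.2 fun j hj hj' => hcon ⟨j, hj, hj'⟩
    simp [this] at h
  · rintro ⟨j, hj, h⟩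
    have h1 : 0 < Nat.count (fun j => ρ j = s ∧ ρ (j + 1) = t) n :=
      count_pos (p := fun j => ρ j = s ∧ ρ (j + 1) = t) hj h
    have h2 : 0 < Nat.count (fun j => ρ j = s) n := count_pos (p := fun j => ρ j = s) hj h.1
    exact div_pos (Nat.cast_pos.2 h1) (Nat.cast_pos.2 h2)

lemma sum_estMatrix_runPrefix [Fintype S] {s v : S} (h : pathEdge (runPrefix ρ n) s v) :
    ∑ t, estMatrix (runPrefix ρ n) s t = 1 := by
  have hsum : ∀ n, ∑ t, Nat.count (fun j => ρ j = s ∧ ρ (j + 1) = t) n =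
      Nat.count (fun j => ρ j = s) n := by
    intro n
    induction n with
    | zero => simp
    | succ n ih =>
      simp_rw [Nat.count_succ, Finset.sum_add_distrib, ih]
      by_cases hs : ρ n = s <;> simp [hs]
  obtain ⟨j, hj, h, -⟩ := (pathEdge_runPrefix ρ).1 h
  have h2 : 0 < Nat.count (fun j => ρ j = s) n :=
    count_pos (p := fun j => ρ j = s) hj h
  simp_rw [estMatrix, transCount_runPrefix, stateCount_runPrefix, ← Finset.sum_div]
  rw [← Nat.cast_sum, hsum, div_self (Nat.cast_pos.2 h2).ne']

lemma isIrredOn_estMatrix [Fintype S] {C : Finset S}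
    (hC : candidate (runPrefix ρ n) = some C) : IsIrredOn (estMatrix (runPrefix ρ n)) C := by
  rw [candidate_eq_some_iff, isCandidate_runPrefix_iff] at hC
  refine IsBSCC.isIrredOn ?_ (estMatrix_nonneg _) fun s hs => ?_
  · simpa only [estMatrix_runPrefix_pos_iff] using hC.1
  · obtain ⟨v, hv⟩ := hC.1.1.prop.exists_edge hs
    exact sum_estMatrix_runPrefix hv

end estMatrix

/-! ### The required strengths -/

lemma rpow_bsccStrength {p δ : ℝ} (h0 : 0 < p) (h1 : p < 1) (hδ : 0 < δ) (i : ℕ) :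
    (1 - p) ^ bsccStrength p δ i = δ * (1 / 2) ^ i := by
  have hp : 0 < 1 - p := by linarith
  have hlog : Real.log (1 - p) < 0 := Real.log_neg hp (by linarith)
  have hlog' := hlog.ne
  have h2 : 0 < Real.log 2 := Real.log_pos (by norm_num)
  rw [Real.rpow_def_of_pos hp, bsccStrength, Real.logb, Real.logb]
  have : Real.log (1 - p) * ((i - Real.log δ / Real.log 2) / -(Real.log (1 - p) / Real.log 2)) =
      Real.log δ + i * -Real.log 2 := by
    field_simp
    ring
  rw [this, Real.exp_add, Real.exp_log hδ, Real.exp_nat_mul, Real.exp_neg, Real.exp_log two_pos,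
    one_div]

lemma transErr_pos {p ε : ℝ} (hp : 0 < p) (hε : 0 < ε) {m : ℕ} (hm : 0 < m) :
    0 < transErr p ε m := by
  have : (0 : ℝ) < m := Nat.cast_pos.2 hm
  exact mul_pos hp (sub_pos.2 (Real.one_lt_rpow (by linarith) (by positivity)))

lemma exp_mpStrength {p ε δ : ℝ} (hp : 0 < p) (hε : 0 < ε) (hδ : 0 < δ) {m : ℕ} (hm : 0 < m) :
    Real.exp (-(2 * transErr p ε m ^ 2 * mpStrength p ε δ m)) = δ / 2 / (2 * m ^ 2) := by
  have hξ := transErr_pos hp hε hm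
  have hm' : (0 : ℝ) < m := Nat.cast_pos.2 hm
  rw [mpStrength, mul_div_cancel₀ _ (by positivity), neg_sub, Real.exp_sub,
    Real.exp_log (by positivity), Real.exp_log (by positivity)]

namespace MarkovChain

/-! ### Bottom strongly connected components of the chain -/

section

variable {S : Type*} [Fintype S] (M : MarkovChain S)

lemma pmin_le {s t : S} (h : 0 < M.P s t) : M.pmin ≤ M.P s t :=
  csInf_le ⟨0, fun _ hx => hx.1.le⟩ ⟨h, s, t, rfl⟩

lemma pmin_pos : 0 < M.pmin := by
  have hne : Nonempty S := by
    by_contra h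
    rw [not_nonempty_iff] at h
    simpa using M.μ_sum
  have hfin : {x | 0 < x ∧ ∃ s t, x = M.P s t}.Finite :=
    (Set.finite_range fun p : S × S => M.P p.1 p.2).subset fun x ⟨_, s, t, h⟩ => ⟨(s, t), h.symm⟩
  obtain ⟨s⟩ := hne
  obtain ⟨t, -, ht⟩ : ∃ t ∈ Finset.univ, 0 < M.P s t := by
    by_contra! h
    have := Finset.sum_nonpos h
    rw [M.P_sum] at this
    linarith
  exact (Set.Nonempty.csInf_mem (s := {x | 0 < x ∧ ∃ s t, x = M.P s t})
    ⟨_, ht, s, t, rfl⟩ hfin).1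

variable {M}

lemma IsBSCC.mem_of_run {C : Finset S} (hC : M.IsBSCC C) {ρ : ℕ → S}
    (hρ : ∀ n, 0 < M.P (ρ n) (ρ (n + 1))) {i j : ℕ} (hij : i ≤ j) (hi : ρ i ∈ C) : ρ j ∈ C := by
  induction j, hij using Nat.le_induction with
  | base => exact hi
  | succ j _ ih => by_contra h; exact hC.2 _ ih _ h (hρ j)

lemma IsBSCC.eq_of_mem {C D : Finset S} (hC : M.IsBSCC C) (hD : M.IsBSCC D) {s : S}
    (h1 : s ∈ C) (h2 : s ∈ D) : C = D := by
  have key : ∀ C D : Finset S, M.IsBSCC C → M.IsBSCC D → s ∈ C → s ∈ D → C ⊆ D := by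
    intro C D hC hD h1 h2 t ht
    have h := hC.1.prop.2 s h1 t ht
    clear ht
    induction h with
    | single h => by_contra hc; exact hD.2 _ h2 _ hc h
    | tail hab hbc ih =>
      by_contra hc
      exact hD.2 _ ih _ hc hbc
  exact Finset.Subset.antisymm (key C D hC hD h1 h2) (key D C hD hC h2 h1)

/-- A run that uses positive transitions only and visits the successors of recurrent states
infinitely often ends up in a BSCC, namely in the set of the states visited infinitely often. -/
lemma exists_limit_isBSCC {ρ : ℕ → S} (hρ : ∀ n, 0 < M.P (ρ n) (ρ (n + 1)))
    (hrec : ∀ s t, 0 < M.P s t → (∃ᶠ n in atTop, ρ n = s) → ∃ᶠ n in atTop, ρ n = t) :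
    ∃ (D : Finset S) (T : ℕ), M.IsBSCC D ∧ (∀ j, ρ j ∈ D ↔ T ≤ j) ∧
      ∀ s ∈ D, ∃ᶠ n in atTop, ρ n = s := by
  classical
  obtain ⟨D, hD⟩ : ∃ D : Finset S, ∀ s, s ∈ D ↔ ∃ᶠ n in atTop, ρ n = s :=
    ⟨Finset.univ.filter fun s => ∃ᶠ n in atTop, ρ n = s, fun s => by simp⟩
  have hev : ∀ᶠ n in atTop, ρ n ∈ D := by
    have : ∀ᶠ n in atTop, ∀ s, s ∉ D → ρ n ≠ s := by
      rw [eventually_all]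
      intro s
      by_cases hs : s ∈ D
      · simp [hs]
      · filter_upwards [not_frequently.1 fun h => hs ((hD s).2 h)] with n hn _ using hn
    filter_upwards [this] with n hn
    by_contra h
    exact hn _ h rfl
  have hclosed : ∀ s ∈ D, ∀ t, t ∉ D → ¬ 0 < M.P s t := fun s hs t ht h =>
    ht ((hD t).2 (hrec s t h ((hD s).1 hs)))
  have hpath : ∀ i j, i < j → Relation.TransGen (fun s t => 0 < M.P s t) (ρ i) (ρ j) := by
    intro i j hij
    induction j, hij using Nat.le_induction with
    | base => exact .single (hρ i)
    | succ j _ ih => exact ih.tail (hρ j)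
  have hB : M.IsBSCC D := by
    refine isBSCC_iff.2 ⟨⟨?_, fun s hs t ht => ?_⟩, hclosed⟩
    · obtain ⟨n, hn⟩ := hev.exists
      exact ⟨_, hn⟩
    · obtain ⟨i, -, rfl⟩ := frequently_atTop.1 ((hD s).1 hs) 0
      obtain ⟨j, hj, rfl⟩ := frequently_atTop.1 ((hD t).1 ht) (i + 1)
      exact hpath i j hj
  refine ⟨D, Nat.find hev.exists, hB, fun j => ⟨fun h => Nat.find_min' _ h, fun h => ?_⟩,
    fun s hs => (hD s).1 hs⟩
  exact hB.mem_of_run hρ h (Nat.find_spec hev.exists)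

end

variable {S : Type*} [Fintype S] [DecidableEq S] [MeasurableSpace S] [DiscreteMeasurableSpace S]

/-! ### Wrong answers of `ReachedBSCC` -/

/-- The `i`-th candidate is accepted wrongly with probability at most `δ 2⁻ⁱ`: given the path up to
its birth, it has an exit that the run has to avoid at each visit. -/
lemma wrong_candidate_le (M : MarkovChain S) {δ : ℝ} (hδ : 0 < δ) (i : ℕ) :
    M.runMeasure {ρ | (∀ n, 0 < M.P (ρ n) (ρ (n + 1))) ∧ ∃ n C, ¬ M.IsBSCC C ∧
        candidateIndex (runPrefix ρ n) = i ∧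
        IsStrongKCandidate (bsccStrength M.pmin δ i) C (runPrefix ρ n)} ≤
      ENNReal.ofReal (δ * (1 / 2) ^ i) := by
  refine M.runMeasure_le_of_first_time (B := fun n ρ => candidateIndex (runPrefix ρ n) = i)
    (fun n ρ ρ' h hB => by rwa [runPrefix_congr h]) (fun ρ ⟨_, n, _, _, h, _⟩ => ⟨n, h⟩) ?_
  intro n a hn hfirst
  -- the birth of an accepted candidate is the time `n`
  have hbirth : ∀ ρ : ℕ → S, (∀ i ≤ n, ρ i = a i) → ∀ n' C,
      candidateIndex (runPrefix ρ n') = i →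
      IsStrongKCandidate (bsccStrength M.pmin δ i) C (runPrefix ρ n') →
      candidate (runPrefix a n) = some C ∧ ∃ m, (∀ j ≤ m, ρ (n + j) ∈ C) ∧
        ∀ s ∈ C, bsccStrength M.pmin δ i ≤ Nat.count (fun j => ρ (n + j) = s) m := by
    intro ρ hρ n' C hi hC
    obtain ⟨n₀, m, -, h1, h2, h3, h4, h5⟩ := hC.birth
    rw [hi] at h3
    have hpre : ∀ j ≤ n, runPrefix ρ j = runPrefix a j := fun j hj =>
      runPrefix_congr fun i hi => hρ i (hi.trans hj)
    obtain rfl : n₀ = n := by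
      rcases lt_trichotomy n₀ n with h | h | h
      · exact absurd (by rw [← hpre n₀ h.le]; exact h3) (hfirst n₀ h)
      · exact h
      · have := h2 n h
        rw [h3, hpre n le_rfl, hn] at this
        exact absurd this (lt_irrefl _)
    exact ⟨by rw [← hpre n₀ le_rfl]; exact h1, m, h4, h5⟩
  cases hcand : candidate (runPrefix a n) with
  | none =>
    refine (measure_mono_null (t := ∅) ?_ measure_empty).trans_le zero_le
    rintro ρ ⟨hρ, -, n', C, -, hi, hC⟩
    exact absurd ((hbirth ρ hρ n' C hi hC).1.symm.trans hcand) (by simp)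
  | some C =>
    have hBC : _root_.IsBSCC (pathEdge (runPrefix a n)) C := by
      rw [candidate_eq_some_iff] at hcand
      exact hcand.choose_spec.2.2
    by_cases hexit : ∃ s ∈ C, ∃ t, t ∉ C ∧ 0 < M.P s t ∧ M.pmin < 1
    · obtain ⟨s, hs, t, ht, hst, hp⟩ := hexit
      have h := M.avoid_le (M.pmin_le hst) M.pmin_pos.le hp n a (bsccStrength M.pmin δ i)
      rw [rpow_bsccStrength M.pmin_pos hp hδ] at h
      refine (measure_mono ?_).trans h
      rintro ρ ⟨hρ, -, n', C', -, hi, hC⟩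
      obtain ⟨h1, m, h2, h3⟩ := hbirth ρ hρ n' C' hi hC
      obtain rfl : C = C' := Option.some_injective _ (hcand.symm.trans h1)
      refine ⟨hρ, m, h3 s hs, fun j hj _ h => ht ?_⟩
      rw [← h]
      exact h2 (j + 1) (by omega)
    · -- otherwise the candidate is a BSCC of the chain
      refine (measure_mono_null (t := ∅) ?_ measure_empty).trans_le zero_le
      rintro ρ ⟨hρ, hpos, n', C', hnot, hi, hC⟩
      obtain ⟨h1, -⟩ := hbirth ρ hρ n' C' hi hC
      obtain rfl : C = C' := Option.some_injective _ (hcand.symm.trans h1)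
      have hedge : ∀ s t, pathEdge (runPrefix a n) s t → 0 < M.P s t := by
        intro s t h
        obtain ⟨j, hj, rfl, rfl⟩ := (pathEdge_runPrefix a).1 h
        rw [← hρ j hj.le, ← hρ (j + 1) hj]
        exact hpos j
      refine hnot (isBSCC_iff.2 ⟨⟨hBC.1.prop.1, fun s hs t ht =>
        Relation.TransGen.mono hedge _ _ (hBC.1.prop.2 s hs t ht)⟩, fun s hs t ht hst => ?_⟩)
      -- an exit has probability one, but the path has taken another transition
      have hp : 1 ≤ M.P s t := by
        by_contra h
        exact hexit ⟨s, hs, t, ht, hst, (M.pmin_le hst).trans_lt (not_le.1 h)⟩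
      obtain ⟨v, hv⟩ := hBC.1.prop.exists_edge hs
      have hvt : v ≠ t := fun h => hBC.2 s hs t ht (h ▸ hv)
      have hsum : M.P s v + M.P s t ≤ 1 := by
        rw [← M.P_sum s, ← Finset.sum_pair hvt]
        exact Finset.sum_le_sum_of_subset_of_nonneg (Finset.subset_univ _)
          fun _ _ _ => M.P_nonneg _ _
      linarith [hedge s v hv]

/-- `ReachedBSCC` ever accepts a candidate wrongly with probability at most `δ`. -/
lemma reachedBSCC_wrong_le (M : MarkovChain S) {δ : ℝ} (hδ : 0 < δ) :
    M.runMeasure {ρ | (∀ n, 0 < M.P (ρ n) (ρ (n + 1))) ∧ ∃ n C, ¬ M.IsBSCC C ∧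
        candidate (runPrefix ρ n) = some C ∧ ReachedBSCC M.pmin δ (runPrefix ρ n)} ≤
      ENNReal.ofReal δ := by
  have hsub : {ρ : ℕ → S | (∀ n, 0 < M.P (ρ n) (ρ (n + 1))) ∧ ∃ n C, ¬ M.IsBSCC C ∧
        candidate (runPrefix ρ n) = some C ∧ ReachedBSCC M.pmin δ (runPrefix ρ n)} ⊆
      ⋃ i : ℕ, {ρ | (∀ n, 0 < M.P (ρ n) (ρ (n + 1))) ∧ ∃ n C, ¬ M.IsBSCC C ∧
        candidateIndex (runPrefix ρ n) = i + 1 ∧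
        IsStrongKCandidate (bsccStrength M.pmin δ (i + 1 : ℕ)) C (runPrefix ρ n)} := by
    rintro ρ ⟨hρ, n, C, hnot, hC, h1, C', hC', hs⟩
    obtain rfl : C = C' := Option.some_injective _ (hC.symm.trans hC')
    obtain ⟨i, hi⟩ := Nat.exists_eq_add_of_le' h1
    rw [hi] at hs
    exact Set.mem_iUnion.2 ⟨i, hρ, n, C, hnot, hi, hs⟩
  refine (measure_mono hsub).trans ((measure_iUnion_le _).trans ?_)
  refine (ENNReal.tsum_le_tsum fun i => M.wrong_candidate_le hδ (i + 1)).trans (le_of_eq ?_)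
  have hs : HasSum (fun i : ℕ => δ * (1 / 2) ^ (i + 1)) δ := by
    have := (hasSum_geometric_two' δ)
    convert this using 2 with i
    rw [pow_succ, one_div, inv_pow]
    ring
  rw [← ENNReal.ofReal_tsum_of_nonneg (fun i => by positivity) hs.summable, hs.tsum_eq]

/-! ### Wrong estimates -/

/-- A BSCC is accepted with a wrong estimate of its transition probabilities with probability at
most `δ / 2`: given the path up to the first state in a BSCC, only the transitions in that BSCC
matter, and Hoeffding's inequality applies to each of them. -/
lemma wrong_estimate_le (M : MarkovChain S) {ε δ : ℝ} (hε : 0 < ε) (hδ : 0 < δ) :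
    M.runMeasure {ρ | (∀ n, 0 < M.P (ρ n) (ρ (n + 1))) ∧ ∃ n C, M.IsBSCC C ∧
        IsStrongKCandidate (mpStrength M.pmin ε δ C.card) C (runPrefix ρ n) ∧
        ∃ s ∈ C, ∃ t ∈ C, transErr M.pmin ε C.card ≤
          |estMatrix (runPrefix ρ n) s t - M.P s t|} ≤
      ENNReal.ofReal (δ / 2) := by
  refine M.runMeasure_le_of_first_time (B := fun n ρ => ∃ D, M.IsBSCC D ∧ ρ n ∈ D)
    (fun n ρ ρ' h hB => by rwa [h n le_rfl]) ?_ ?_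
  · rintro ρ ⟨-, n, C, hC, hs, -⟩
    obtain ⟨n₀, -, -, h, -⟩ := hs.birth
    exact ⟨n₀, C, hC, mem_of_candidate h⟩
  rintro n a ⟨D, hD, haD⟩ hfirst
  have hm : 0 < D.card := Finset.card_pos.2 ⟨_, haD⟩
  have hξ := transErr_pos M.pmin_pos hε hm
  have hsub : {ρ : ℕ → S | ∀ i ≤ n, ρ i = a i} ∩
      {ρ | (∀ n, 0 < M.P (ρ n) (ρ (n + 1))) ∧ ∃ n C, M.IsBSCC C ∧
        IsStrongKCandidate (mpStrength M.pmin ε δ C.card) C (runPrefix ρ n) ∧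
        ∃ s ∈ C, ∃ t ∈ C, transErr M.pmin ε C.card ≤
          |estMatrix (runPrefix ρ n) s t - M.P s t|} ⊆
      ⋃ s ∈ D, ⋃ t ∈ D, {ρ | (∀ i ≤ n, ρ i = a i) ∧ ∃ m : ℕ,
        mpStrength M.pmin ε δ D.card ≤ Nat.count (fun j => ρ (n + j) = s) m ∧
        transErr M.pmin ε D.card * Nat.count (fun j => ρ (n + j) = s) m ≤
          |Nat.count (fun j => ρ (n + j) = s ∧ ρ (n + j + 1) = t) m -
            M.P s t * Nat.count (fun j => ρ (n + j) = s) m|} := by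
    rintro ρ ⟨hρ, hpos, n', C, hC, hstrong, s, hs, t, ht, hdev⟩
    obtain ⟨n₀, m₀, rfl, -, -, -, hin, hcount⟩ := hstrong.birth
    have hlast : ρ (n₀ + m₀) ∈ C := hin m₀ le_rfl
    have hn : n ≤ n₀ + m₀ := by
      by_contra h
      refine hfirst (n₀ + m₀) (by omega) ⟨C, hC, ?_⟩
      rw [← hρ _ (by omega)]
      exact hlast
    obtain rfl : C = D :=
      hC.eq_of_mem hD hlast (hD.mem_of_run hpos hn (by rw [hρ n le_rfl]; exact haD))
    obtain ⟨m, hnm⟩ := Nat.exists_eq_add_of_le hn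
    -- no state of the BSCC is visited before `n`
    have hbefore : ∀ j < n, ρ j ≠ s := fun j hj h =>
      hfirst j hj ⟨C, hC, by rw [← hρ j hj.le, h]; exact hs⟩
    have hN : Nat.count (fun j => ρ j = s) (n + m) = Nat.count (fun j => ρ (n + j) = s) m := by
      rw [Nat.count_add, Nat.count_iff_forall_not.2 hbefore, zero_add]
    have hN2 : Nat.count (fun j => ρ j = s ∧ ρ (j + 1) = t) (n + m) =
        Nat.count (fun j => ρ (n + j) = s ∧ ρ (n + j + 1) = t) m := by
      rw [Nat.count_add, Nat.count_iff_forall_not.2 fun j hj h => hbefore j hj h.1, zero_add]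
    have hk : mpStrength M.pmin ε δ C.card ≤ Nat.count (fun j => ρ (n + j) = s) m := by
      refine (hcount s hs).trans (Nat.cast_le.2 ?_)
      rw [← hN, ← hnm, Nat.count_add]
      exact Nat.le_add_left _ _
    simp only [Set.mem_iUnion]
    refine ⟨s, hs, t, ht, hρ, m, hk, ?_⟩
    rw [estMatrix, transCount_runPrefix, stateCount_runPrefix, hnm, hN, hN2] at hdev
    rcases Nat.eq_zero_or_pos (Nat.count (fun j => ρ (n + j) = s) m) with h0 | h0
    · rw [h0, Nat.cast_zero, mul_zero]
      exact abs_nonneg _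
    · have h0' : (0 : ℝ) < Nat.count (fun j => ρ (n + j) = s) m := Nat.cast_pos.2 h0
      refine (mul_le_mul_of_nonneg_right hdev h0'.le).trans (le_of_eq ?_)
      rw [← abs_of_pos h0', ← abs_mul, abs_of_pos h0', sub_mul, div_mul_cancel₀ _ h0'.ne']
  refine (measure_mono hsub).trans ((measure_biUnion_finset_le _ _).trans ?_)
  refine (Finset.sum_le_sum fun s _ => (measure_biUnion_finset_le _ _).trans
    (Finset.sum_le_sum fun t _ => M.deviation_le s t hξ n a _)).trans (le_of_eq ?_)
  have hm' : (0 : ℝ) < D.card := Nat.cast_pos.2 hm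
  simp only [Finset.sum_const, nsmul_eq_mul]
  rw [exp_mpStrength M.pmin_pos hε hδ hm, ← ENNReal.ofReal_natCast,
    show ∀ c x y : ENNReal, c * (c * (x * y)) = x * (c * (c * y)) from fun _ _ _ => by ring,
    ← ENNReal.ofReal_mul hm'.le, ← ENNReal.ofReal_mul hm'.le]
  congr 2
  field_simp

end MarkovChain

theorem theorem4 {S : Type*} [Fintype S] [DecidableEq S] [MeasurableSpace S]
    [DiscreteMeasurableSpace S] (M : MarkovChain S) (r : S → ℝ) (hr : ∀ s, r s ∈ Set.Icc (0 : ℝ) 1)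
    (ε δ : ℝ) (hε : 0 < ε) (hδ : 0 < δ) :
    ENNReal.ofReal (1 - δ) ≤
      M.runMeasure {ρ | ∃ (C : Finset S) (xhat x : ℝ),
        SinglePathMPReturns r M.pmin ε δ ρ C xhat ∧ M.IsBSCC C ∧
          HasMeanPayoff M.P r C x ∧ |xhat - x| < ε} := by
  classical
  set G : Set (ℕ → S) := {ρ | ∃ (C : Finset S) (xhat x : ℝ),
    SinglePathMPReturns r M.pmin ε δ ρ C xhat ∧ M.IsBSCC C ∧
      HasMeanPayoff M.P r C x ∧ |xhat - x| < ε}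
  set W₁ : Set (ℕ → S) := {ρ | (∀ n, 0 < M.P (ρ n) (ρ (n + 1))) ∧ ∃ n C, ¬ M.IsBSCC C ∧
    candidate (runPrefix ρ n) = some C ∧ ReachedBSCC M.pmin (δ / 2) (runPrefix ρ n)}
  set W₂ : Set (ℕ → S) := {ρ | (∀ n, 0 < M.P (ρ n) (ρ (n + 1))) ∧ ∃ n C, M.IsBSCC C ∧
    IsStrongKCandidate (mpStrength M.pmin ε δ C.card) C (runPrefix ρ n) ∧
    ∃ s ∈ C, ∃ t ∈ C, transErr M.pmin ε C.card ≤
      |estMatrix (runPrefix ρ n) s t - M.P s t|}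
  have hcover : ∀ᵐ ρ ∂M.runMeasure, ρ ∈ G ∪ (W₁ ∪ W₂) := by
    filter_upwards [M.ae_transition_pos, M.ae_frequently_succ] with ρ hpos hrec
    by_contra hcon
    simp only [Set.mem_union, not_or] at hcon
    obtain ⟨hnG, hn1, hn2⟩ := hcon
    obtain ⟨D, T, -, hDT, hf⟩ := MarkovChain.exists_limit_isBSCC hpos hrec
    have hex := exists_singlePathMPUntil hDT hf M.pmin ε δ
    obtain ⟨n, hn, hmin⟩ : ∃ n, SinglePathMPUntil M.pmin ε δ (runPrefix ρ n) ∧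
        ∀ m < n, ¬ SinglePathMPUntil M.pmin ε δ (runPrefix ρ m) :=
      ⟨Nat.find hex, Nat.find_spec hex, fun m hm => Nat.find_min hex hm⟩
    obtain ⟨hreach, C, hC, hstrong⟩ := hn
    have hB : M.IsBSCC C := by
      by_contra hB
      exact hn1 ⟨hpos, n, C, hB, hC, hreach⟩
    have hest : ∀ s ∈ C, ∀ t ∈ C,
        |estMatrix (runPrefix ρ n) s t - M.P s t| < transErr M.pmin ε C.card := by
      intro s hs t ht
      by_contra h
      exact hn2 ⟨hpos, n, C, hB, hstrong, s, hs, t, ht, not_lt.1 h⟩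
    have hd : ∀ s ∈ C, ∀ t ∈ C, |estMatrix (runPrefix ρ n) s t - M.P s t| ≤
        ((1 + ε) ^ (1 / (2 * (C.card : ℝ))) - 1) * M.P s t := by
      intro s hs t ht
      rcases (M.P_nonneg s t).eq_or_lt with h0 | h0
      · -- an impossible transition has not been observed
        have : estMatrix (runPrefix ρ n) s t = 0 := by
          refine le_antisymm (not_lt.1 fun h => ?_) (estMatrix_nonneg _ _ _)
          obtain ⟨j, -, rfl, rfl⟩ := (pathEdge_runPrefix ρ).1 (estMatrix_runPrefix_pos_iff.1 h)
          exact absurd h0 (hpos j).ne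
        rw [← h0, this]
        simp
      · have hm : (0 : ℝ) < C.card := Nat.cast_pos.2 (Finset.card_pos.2 ⟨_, mem_of_candidate hC⟩)
        refine (hest s hs t ht).le.trans ?_
        rw [transErr, mul_comm]
        exact mul_le_mul_of_nonneg_left (M.pmin_le h0)
          (sub_nonneg.2 (Real.one_le_rpow (by linarith) (by positivity)))
    obtain ⟨x', x, h1, h2, h3⟩ := exists_hasMeanPayoff_close (Q := M.P)
      (Q' := estMatrix (runPrefix ρ n)) (C := C) ⟨_, mem_of_candidate hC⟩
      (IsBSCC.isIrredOn hB M.P_nonneg fun s _ => M.P_sum s) (isIrredOn_estMatrix hC) hε hd hr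
    exact hnG ⟨C, x', x, ⟨n, ⟨hreach, C, hC, hstrong⟩, hmin, hC, h1⟩, hB, h2, h3⟩
  have h1 : (1 : ENNReal) ≤ M.runMeasure G + ENNReal.ofReal δ := by
    calc (1 : ENNReal) = M.runMeasure Set.univ := measure_univ.symm
      _ ≤ M.runMeasure (G ∪ (W₁ ∪ W₂)) := measure_mono_ae (by
          filter_upwards [hcover] with ρ hρ _ using hρ)
      _ ≤ M.runMeasure G + (M.runMeasure W₁ + M.runMeasure W₂) :=
          (measure_union_le _ _).trans (add_le_add le_rfl (measure_union_le _ _))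
      _ ≤ M.runMeasure G + (ENNReal.ofReal (δ / 2) + ENNReal.ofReal (δ / 2)) :=
          add_le_add le_rfl (add_le_add (M.reachedBSCC_wrong_le (half_pos hδ))
            (M.wrong_estimate_le hε hδ))
      _ = M.runMeasure G + ENNReal.ofReal δ := by
          rw [← ENNReal.ofReal_add (by positivity) (by positivity), add_halves]
  rw [ENNReal.ofReal_sub _ hδ.le, ENNReal.ofReal_one]
  exact tsub_le_iff_right.2 h1
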